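/- **Setting (repeated bilateral trade, oblivious adversary, one-bit feedback).** Let $T\ge 1$ be the known number of rounds. An oblivious adversary fixes in advance valuations $(s_t,b_t)\in[0,1]^2$, $t=1,\dots,T$ (seller and buyer). In round $t$ a (randomized) learner posts prices $(p_t,q_t)\in[0,1]^2$, $p_t$ to the seller and $q_t$ to the buyer, and then observes only the bit $\mathbb I\{s_t\le p_t,\ q_t\le b_t\}$; its prices depend only on its internal randomness and on the previously observed bits. For prices $(p,q)$ put $$\mathrm{GFT}_t(p,q)=(b_t-s_t)\,\mathbb I\{s_t\le p,\ q\le b_t\},\qquad \mathrm{Rev}_t(p,q)=(q-p)\,\mathbb I\{s_t\le p,\ q\le b_t\},$$ and define the regret and the global budget violation $$R_T=\max_{p\in[0,1]}\sum_{t=1}^T\mathrm{GFT}_t(p,p)-\sum_{t=1}^T\mathrm{GFT}_t(p_t,q_t),\qquad V_T=-\sum_{t=1}^T\mathrm{Rev}_t(p_t,q_t).$$ **Theorem.** There are universal constants $C>0$ and $k\in\mathbb N$ such that for every $\beta\in[3/4,6/7]$, every $\delta\in(0,1)$ and every $T\ge 1$ there is a learning algorithm (which may depend on $\beta,\delta,T$)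 with the following guarantees for every sequence of valuations $(s_t,b_t)_{t=1}^T\in([0,1]^2)^T$: 1. deterministically, i.e. for every realization of the algorithm's randomness, $V_T\le C\,T^{\beta}\,(1+\ln T)^k$, that is, $V_T\le\tilde O(T^\beta)$; 2. with probability at least $1-3\delta$, $R_T\le C\,T^{1-\beta/3}\,(1+\ln (T/\delta))^k$, that is, $R_T\le\tilde O(T^{1-\beta/3})$. -/

import Mathlib

open MeasureTheory

noncomputable section

namespace BilateralTrade

/-- The trade indicator: the seller (valuation `s`) accepts the price `p` and the buyer
(valuation `b`) accepts the price `q`. This single bit is the learner's feedback. -/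
def trade (s b p q : ℝ) : Bool := decide (s ≤ p ∧ q ≤ b)

/-- Gain from trade of the prices `(p, q)` at valuations `(s, b)`. -/
def gft (s b p q : ℝ) : ℝ := if trade s b p q then b - s else 0

/-- Revenue of the prices `(p, q)` at valuations `(s, b)`. -/
def rev (s b p q : ℝ) : ℝ := if trade s b p q then q - p else 0

/-- A randomized learning algorithm with one-bit feedback. Its internal randomness is a seed drawn
from a probability space `Ω`. The two prices posted in a round are measurable functions of the seed
and of the list of feedback bits of the previous rounds (most recent first), and of nothing else:
the number of the round is the length of the list, and the prices of the previous rounds are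
themselves functions of the seed and of the earlier bits. -/
structure Learner where
  Ω : Type
  [mΩ : MeasurableSpace Ω]
  μ : Measure Ω
  [isProb : IsProbabilityMeasure μ]
  sellerPrice : List Bool → Ω → ℝ
  buyerPrice : List Bool → Ω → ℝ
  measurable_sellerPrice : ∀ h, Measurable (sellerPrice h)
  measurable_buyerPrice : ∀ h, Measurable (buyerPrice h)
  sellerPrice_mem : ∀ h ω, sellerPrice h ω ∈ Set.Icc (0 : ℝ) 1
  buyerPrice_mem : ∀ h ω, buyerPrice h ω ∈ Set.Icc (0 : ℝ) 1

attribute [instance] Learner.mΩ Learner.isProb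

namespace Learner

/-- The feedback bits received in the first `t` rounds (most recent first), when the valuations in
the rounds are `(s 0, b 0), (s 1, b 1), …`. -/
def history (A : Learner) (s b : ℕ → ℝ) (ω : A.Ω) : ℕ → List Bool
  | 0 => []
  | t + 1 =>
    trade (s t) (b t) (A.sellerPrice (A.history s b ω t) ω) (A.buyerPrice (A.history s b ω t) ω)
      :: A.history s b ω t

/-- The price posted to the seller in the round with valuations `(s t, b t)`. -/
def p (A : Learner) (s b : ℕ → ℝ) (ω : A.Ω) (t : ℕ) : ℝ := A.sellerPrice (A.history s b ω t) ω

/-- The price posted to the buyer in the round with valuations `(s t, b t)`. -/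
def q (A : Learner) (s b : ℕ → ℝ) (ω : A.Ω) (t : ℕ) : ℝ := A.buyerPrice (A.history s b ω t) ω

/-- The budget violation over the first `T` rounds. -/
def violation (A : Learner) (s b : ℕ → ℝ) (T : ℕ) (ω : A.Ω) : ℝ :=
  -∑ t ∈ Finset.range T, rev (s t) (b t) (A.p s b ω t) (A.q s b ω t)

end Learner

/-- The total gain from trade of the best fixed price in hindsight. The supremum is a maximum,
see `exists_benchmark_eq`. -/
def benchmark (s b : ℕ → ℝ) (T : ℕ) : ℝ :=
  sSup ((fun x => ∑ t ∈ Finset.range T, gft (s t) (b t) x x) '' Set.Icc (0 : ℝ) 1)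

theorem exists_benchmark_eq (s b : ℕ → ℝ) (T : ℕ) :
    IsGreatest ((fun x => ∑ t ∈ Finset.range T, gft (s t) (b t) x x) '' Set.Icc (0 : ℝ) 1)
      (benchmark s b T) := by
  have hfin : ((fun x => ∑ t ∈ Finset.range T, gft (s t) (b t) x x) ''
      Set.Icc (0 : ℝ) 1).Finite := by
    refine (Set.finite_range (fun f : Finset.range T → Bool =>
      ∑ t : Finset.range T, if f t then b t - s t else 0)).subset ?_
    rintro _ ⟨x, -, rfl⟩
    refine ⟨fun t => trade (s t) (b t) x x, ?_⟩
    exact Finset.sum_coe_sort (Finset.range T) (fun t => gft (s t) (b t) x x)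
  have hne : ((fun x => ∑ t ∈ Finset.range T, gft (s t) (b t) x x) ''
      Set.Icc (0 : ℝ) 1).Nonempty := ⟨_, ⟨0, by simp, rfl⟩⟩
  exact ⟨hne.csSup_mem hfin, fun _ hx => le_csSup hfin.bddAbove hx⟩

/-- The regret over the first `T` rounds against the best fixed price in hindsight. -/
def Learner.regret (A : Learner) (s b : ℕ → ℝ) (T : ℕ) (ω : A.Ω) : ℝ :=
  benchmark s b T - ∑ t ∈ Finset.range T, gft (s t) (b t) (A.p s b ω t) (A.q s b ω t)

end BilateralTrade

end

/-!
The learner is exponential weights over the cells of a fine price grid, with an adaptive partition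
of the prices and random probes.

Put `K = 2 ^ a ≈ T ^ (1 - β)`. The price interval is cut into `K` blocks, each of `K` cells; the
cells are the experts. In every round each block is divided into some power of two of equal
leaves, and an expert plays the leaf that contains its cell: it offers the seller the upper end
and the buyer the lower end. A trade at a fixed price inside the leaf is then also a trade of the
expert, and every posted pair overpays by at most the width `1 / K` of a block, so that the budget
violation is at most `T / K` for every realization (`actionPrices_fst_le`).

The expert loses against a price in its leaf only when both valuations lie in the leaf, in the
wrong order, and then at most the width of the leaf (`gft_le_gridGain_leafPrices`). So blocks are
refined in proportion to the number of rounds, so far, with both valuations in the block: since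
these numbers add up to at most `T`, there are never more than `6 * K` leaves
(`levels_eq_rawLevel`), and still the loss sums to `O(T / K ^ 2)` up to logarithms
(`inv_two_pow_rawLevel_le`, `sum_div_partial_sum_le`). For `β ≤ 6 / 7` this is at most
`T ^ (1 - β / 3)`.

With probability of order `γ = (K / T) ^ (1 / 3) / 2` a round is spent on a probe. The identity
`b - s = b + (1 - s) - 1`, with `b` and `1 - s` written as averages of threshold indicators, turns
one bit into an unbiased estimate of the gain of a leaf (`sum_mixture_gainEst`), and inclusion and
exclusion over the four pairs of end points of a block estimates the indicator that both
valuations lie in it (`sum_mixture_countEst`). The estimates have second moment `O(K / γ)`, so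
exponential weights with rate `η` of order `γ ^ 2 / K` have regret of order
`γ * T + log K / η + η * T * K / γ`, that is `K ^ (1 / 3) * T ^ (2 / 3) ≤ T ^ (1 - β / 3)` up to
logarithms.

The randomness enters only through exponential supermartingales (`exists_learner_of_policy`,
`sum_mixture_exp_roundTerm_le`, `sum_mixture_exp_countEst_le`): one for the regret, failing with
probability `δ`, and two for the count of each block at each time, failing with total probability
`2 * δ`. The counts are accurate up to `T / K`, up to logarithms, because `K ^ 4 ≤ T`, which is
the condition `β ≥ 3 / 4`.
-/

noncomputable section

namespace BilateralTrade

/-! ### Learners from behavioural policies -/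

/-- A finite probability vector is the law of a measurable function of a uniform variable. -/
theorem exists_measurable_sampler {Act : Type} [Fintype Act] [MeasurableSpace Act]
    [DiscreteMeasurableSpace Act] (ρ : Act → ℝ) (h0 : ∀ a, 0 ≤ ρ a) (h1 : ∑ a, ρ a = 1) :
    ∃ f : unitInterval → Act, Measurable f ∧ ∀ g : Act → ENNReal,
      ∫⁻ y, g (f y) = ∑ a, ENNReal.ofReal (ρ a) * g a := by
  have hne : Nonempty Act := by
    by_contra h
    rw [not_nonempty_iff] at h
    simp at h1
  let P : PMF Act := PMF.ofFintype (fun a => ENNReal.ofReal (ρ a)) (by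
    rw [← ENNReal.ofReal_sum_of_nonneg (fun a _ => h0 a), h1, ENNReal.ofReal_one])
  obtain ⟨f, hf, hmap⟩ := P.toMeasure.exists_measurable_map_eq
  refine ⟨f, hf, fun g => ?_⟩
  rw [← lintegral_map (f := g) (by fun_prop) hf, hmap, lintegral_fintype]
  refine Finset.sum_congr rfl fun a _ => ?_
  rw [PMF.toMeasure_apply_singleton _ _ (measurableSet_singleton a), mul_comm]
  rfl

variable {Act : Type}

/-- The record of the past actions and feedback bits (most recent first), reconstructed from the
list of the bits and the sequence `ω` of seeds, when `sel r y` is the action taken after the record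
`r` with the seed `y`. -/
def record (sel : List (Act × Bool) → unitInterval → Act) (ω : ℕ → unitInterval) :
    List Bool → List (Act × Bool)
  | [] => []
  | c :: h => (sel (record sel ω h) (ω h.length), c) :: record sel ω h

/-- The record of the first `t` rounds, when a round `i` in which `a` is played answers with the
bit `bit i r a`. -/
def trajectory (sel : List (Act × Bool) → unitInterval → Act)
    (bit : ℕ → List (Act × Bool) → Act → Bool) (ω : ℕ → unitInterval) : ℕ → List (Act × Bool)
  | 0 => []
  | t + 1 =>
    (sel (trajectory sel bit ω t) (ω t),
      bit t (trajectory sel bit ω t) (sel (trajectory sel bit ω t) (ω t))) ::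
        trajectory sel bit ω t

theorem trajectory_congr (sel : List (Act × Bool) → unitInterval → Act)
    (bit : ℕ → List (Act × Bool) → Act → Bool) {ω ω' : ℕ → unitInterval} {t : ℕ}
    (h : ∀ i < t, ω i = ω' i) : trajectory sel bit ω t = trajectory sel bit ω' t := by
  induction t with
  | zero => rfl
  | succ t ih =>
    simp only [trajectory]
    rw [ih fun i hi => h i (by omega), h t (by omega)]

section Measurable

variable [Fintype Act] [MeasurableSpace Act]
  [MeasurableSpace (List (Act × Bool))] [DiscreteMeasurableSpace (List (Act × Bool))]

theorem measurable_apply_record {sel : List (Act × Bool) → unitInterval → Act}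
    (hsel : ∀ r, Measurable (sel r)) {Ω : Type*} [MeasurableSpace Ω] {F : Ω → List (Act × Bool)}
    {G : Ω → unitInterval} (hF : Measurable F) (hG : Measurable G) :
    Measurable fun ω => sel (F ω) (G ω) := by
  have h : Measurable fun x : List (Act × Bool) × unitInterval => sel x.1 x.2 :=
    measurable_from_prod_countable_right fun r => hsel r
  exact h.comp (hF.prodMk hG)

variable [DiscreteMeasurableSpace Act]

theorem measurable_record {sel : List (Act × Bool) → unitInterval → Act}
    (hsel : ∀ r, Measurable (sel r)) (h : List Bool) :
    Measurable fun ω => record sel ω h := by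
  induction h with
  | nil => exact measurable_const
  | cons c h ih =>
    have h2 : Measurable fun x : Act × List (Act × Bool) => (x.1, c) :: x.2 :=
      .of_discrete
    exact h2.comp ((measurable_apply_record hsel ih (measurable_pi_apply _)).prodMk ih)

theorem measurable_trajectory {sel : List (Act × Bool) → unitInterval → Act}
    (hsel : ∀ r, Measurable (sel r)) (bit : ℕ → List (Act × Bool) → Act → Bool) (t : ℕ) :
    Measurable fun ω => trajectory sel bit ω t := by
  induction t with
  | zero => exact measurable_const
  | succ t ih =>
    have h2 : Measurable fun x : Act × List (Act × Bool) => (x.1, bit t x.2 x.1) :: x.2 :=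
      .of_discrete
    exact h2.comp ((measurable_apply_record hsel ih (measurable_pi_apply _)).prodMk ih)

/-- The law of the seed: independent uniform variables. -/
abbrev seedLaw : Measure (ℕ → unitInterval) := Measure.infinitePi fun _ => volume

/-- The record of the first `t` rounds is independent of the seed of the next round. -/
theorem map_trajectory_prodMk {sel : List (Act × Bool) → unitInterval → Act}
    (hsel : ∀ r, Measurable (sel r)) (bit : ℕ → List (Act × Bool) → Act → Bool) (t : ℕ) :
    seedLaw.map (fun ω => (trajectory sel bit ω t, ω t)) =
      (seedLaw.map fun ω => trajectory sel bit ω t).prod volume := by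
  have hind : ProbabilityTheory.iIndepFun (fun (i : ℕ) (ω : ℕ → unitInterval) => ω i) seedLaw :=
    ProbabilityTheory.iIndepFun_infinitePi (X := fun _ x => x) fun _ => measurable_id
  have h := hind.indepFun_finset (Finset.range t) {t} (by simp) fun i => measurable_pi_apply i
  let ext : (Finset.range t → unitInterval) → ℕ → unitInterval :=
    fun r i => if hi : i ∈ Finset.range t then r ⟨i, hi⟩ else 0
  have hext : Measurable ext := by
    refine measurable_pi_lambda _ fun i => ?_
    by_cases hi : i ∈ Finset.range t
    · simp only [ext, hi, dif_pos]
      exact measurable_pi_apply (⟨i, hi⟩ : Finset.range t)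
    · simp only [ext, hi, dif_neg, not_false_iff]
      exact measurable_const
  have h' := h.comp ((measurable_trajectory hsel bit t).comp hext)
    (measurable_pi_apply (⟨t, by simp⟩ : ({t} : Finset ℕ)))
  have e : ((fun ω => trajectory sel bit ω t) ∘ ext) ∘
      (fun (a : ℕ → unitInterval) (i : Finset.range t) => a i) =
      fun ω => trajectory sel bit ω t := by
    funext ω
    refine trajectory_congr sel bit fun i hi => ?_
    simp [ext, hi]
  rw [e] at h'
  have := (ProbabilityTheory.indepFun_iff_map_prod_eq_prod_map_map
    (measurable_trajectory hsel bit t).aemeasurable (measurable_pi_apply t).aemeasurable).1 h'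
  rw [Measure.infinitePi_map_eval] at this
  exact this

/-- A product of factors whose conditional means are at most `1` has mean at most `1`. -/
theorem lintegral_prod_trajectory_le {sel : List (Act × Bool) → unitInterval → Act}
    (hsel : ∀ r, Measurable (sel r)) (bit : ℕ → List (Act × Bool) → Act → Bool)
    (g : ℕ → List (Act × Bool) → Act → ENNReal)
    (hg : ∀ t r, ∫⁻ y, g t r (sel r y) ≤ 1) (n : ℕ) :
    ∫⁻ ω, ∏ t ∈ Finset.range n, g t (trajectory sel bit ω t)
      (sel (trajectory sel bit ω t) (ω t)) ∂seedLaw ≤ 1 := by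
  -- the product of the first `n` factors, as a function of the record
  let G : List (Act × Bool) → ENNReal := fun r => r.rec 1 fun x r v => v * g r.length r x.1
  have hlen : ∀ ω t, (trajectory sel bit ω t).length = t := by
    intro ω t
    induction t with
    | zero => rfl
    | succ t ih => simp [trajectory, ih]
  have hG : ∀ ω n, ∏ t ∈ Finset.range n, g t (trajectory sel bit ω t)
      (sel (trajectory sel bit ω t) (ω t)) = G (trajectory sel bit ω n) := by
    intro ω n
    induction n with
    | zero => rfl
    | succ n ih =>
      rw [Finset.prod_range_succ, ih]
      simp only [trajectory, G, hlen]
  induction n with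
  | zero => simp
  | succ n ih =>
    simp_rw [Finset.prod_range_succ]
    simp_rw [hG] at ih ⊢
    have hm : Measurable fun x : List (Act × Bool) × unitInterval =>
        G x.1 * g n x.1 (sel x.1 x.2) := by
      refine measurable_from_prod_countable_right fun r => ?_
      exact ((Measurable.of_discrete (f := g n r)).comp (hsel r)).const_mul (G r)
    have hm' : Measurable fun ω => (trajectory sel bit ω n, ω n) :=
      (measurable_trajectory hsel bit n).prodMk (measurable_pi_apply n)
    rw [← lintegral_map (μ := seedLaw) hm hm', map_trajectory_prodMk hsel bit n,
      lintegral_prod _ hm.aemeasurable]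
    calc _ ≤ ∫⁻ r, G r ∂(seedLaw.map fun ω => trajectory sel bit ω n) := by
          refine lintegral_mono fun r => ?_
          have hm2 : Measurable fun y => g n r (sel r y) :=
            (Measurable.of_discrete (f := g n r)).comp (hsel r)
          dsimp only
          rw [lintegral_const_mul _ hm2]
          exact mul_le_of_le_one_right' (hg n r)
      _ = ∫⁻ ω, G (trajectory sel bit ω n) ∂seedLaw :=
          lintegral_map .of_discrete (measurable_trajectory hsel bit n)
      _ ≤ 1 := ih

end Measurable

/-- A behavioural policy with finitely many actions is realized by a learner: after the record `r`
of actions and bits it plays `a` with probability `ρ r a`, posting the prices `P r a` and `Q r a`.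
The last clause is Markov's inequality for a supermartingale: a sum of terms with exponential
moments at most `1`, conditionally on the past, exceeds `x` with probability at most `exp (-x)`. -/
theorem exists_learner_of_policy [Fintype Act] (ρ P Q : List (Act × Bool) → Act → ℝ)
    (h0 : ∀ r a, 0 ≤ ρ r a) (h1 : ∀ r, ∑ a, ρ r a = 1)
    (hP : ∀ r a, P r a ∈ Set.Icc (0 : ℝ) 1) (hQ : ∀ r a, Q r a ∈ Set.Icc (0 : ℝ) 1) :
    ∃ A : Learner, ∀ s b : ℕ → ℝ, ∃ (rec : ℕ → A.Ω → List (Act × Bool)) (act : ℕ → A.Ω → Act),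
      (∀ ω, rec 0 ω = []) ∧
      (∀ t ω, rec (t + 1) ω = (act t ω, trade (s t) (b t) (P (rec t ω) (act t ω))
        (Q (rec t ω) (act t ω))) :: rec t ω) ∧
      (∀ t ω, A.p s b ω t = P (rec t ω) (act t ω)) ∧
      (∀ t ω, A.q s b ω t = Q (rec t ω) (act t ω)) ∧
      ∀ f : ℕ → List (Act × Bool) → Act → ℝ,
        (∀ t r, ∑ a, ρ r a * Real.exp (f t r a) ≤ 1) → ∀ (n : ℕ) (x : ℝ),
          A.μ.real {ω | x < ∑ t ∈ Finset.range n, f t (rec t ω) (act t ω)} ≤ Real.exp (-x) := by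
  let _ : MeasurableSpace Act := ⊤
  let _ : MeasurableSpace (List (Act × Bool)) := ⊤
  have : DiscreteMeasurableSpace Act := ⟨fun _ => trivial⟩
  have : DiscreteMeasurableSpace (List (Act × Bool)) := ⟨fun _ => trivial⟩
  choose sel hsel hlaw using fun r => exists_measurable_sampler (ρ r) (h0 r) (h1 r)
  have hmeas (F : List (Act × Bool) → Act → ℝ) (h : List Bool) :
      Measurable fun ω => F (record sel ω h) (sel (record sel ω h) (ω h.length)) := by
    have h2 : Measurable fun x : List (Act × Bool) × Act => F x.1 x.2 := .of_discrete
    have h3 := measurable_record hsel h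
    exact h2.comp (h3.prodMk (measurable_apply_record hsel h3 (measurable_pi_apply _)))
  let A : Learner :=
    { Ω := ℕ → unitInterval
      μ := seedLaw
      sellerPrice := fun h ω => P (record sel ω h) (sel (record sel ω h) (ω h.length))
      buyerPrice := fun h ω => Q (record sel ω h) (sel (record sel ω h) (ω h.length))
      measurable_sellerPrice := hmeas P
      measurable_buyerPrice := hmeas Q
      sellerPrice_mem := fun _ _ => hP _ _
      buyerPrice_mem := fun _ _ => hQ _ _ }
  refine ⟨A, fun s b => ?_⟩
  let bit : ℕ → List (Act × Bool) → Act → Bool := fun t r a => trade (s t) (b t) (P r a) (Q r a)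
  have hlen : ∀ (ω : ℕ → unitInterval) t, (A.history s b ω t).length = t := by
    intro ω t
    induction t with
    | zero => rfl
    | succ t ih => simp [Learner.history, ih]
  have hrec : ∀ (ω : ℕ → unitInterval) t,
      record sel ω (A.history s b ω t) = trajectory sel bit ω t := by
    intro ω t
    induction t with
    | zero => rfl
    | succ t ih =>
      have e (F : List (Act × Bool) → Act → ℝ) :
          F (record sel ω (A.history s b ω t))
            (sel (record sel ω (A.history s b ω t)) (ω (A.history s b ω t).length)) =
          F (trajectory sel bit ω t) (sel (trajectory sel bit ω t) (ω t)) := by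
        rw [ih, hlen]
      simp only [Learner.history, record, trajectory, ih, hlen]
      exact congrArg₂ (fun p q => (_, trade (s t) (b t) p q) :: _) (e P) (e Q)
  refine ⟨fun t ω => trajectory sel bit ω t, fun t ω => sel (trajectory sel bit ω t) (ω t),
    fun _ => rfl, fun _ _ => rfl, ?_, ?_, ?_⟩
  · intro t ω
    change P (record sel ω (A.history s b ω t)) _ = _
    rw [hrec, hlen]
  · intro t ω
    change Q (record sel ω (A.history s b ω t)) _ = _
    rw [hrec, hlen]
  · intro f hf n x
    have hint := lintegral_prod_trajectory_le hsel bit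
      (fun t r a => ENNReal.ofReal (Real.exp (f t r a))) (fun t r => by
        rw [hlaw r fun a => ENNReal.ofReal (Real.exp (f t r a))]
        simp_rw [← ENNReal.ofReal_mul (h0 r _)]
        rw [← ENNReal.ofReal_sum_of_nonneg fun a _ => mul_nonneg (h0 r a) (Real.exp_pos _).le]
        exact ENNReal.ofReal_le_one.2 (hf t r)) n
    simp_rw [← ENNReal.ofReal_prod_of_nonneg fun _ _ => (Real.exp_pos _).le, ← Real.exp_sum]
      at hint
    set S : (ℕ → unitInterval) → ℝ := fun ω => ∑ t ∈ Finset.range n,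
      f t (trajectory sel bit ω t) (sel (trajectory sel bit ω t) (ω t)) with hS
    have hSm : Measurable S := by
      refine Finset.measurable_sum _ fun t _ => ?_
      have h2 : Measurable fun y : List (Act × Bool) × Act => f t y.1 y.2 := .of_discrete
      have h3 := measurable_trajectory hsel bit t
      exact h2.comp (h3.prodMk (measurable_apply_record hsel h3 (measurable_pi_apply _)))
    have hmk := mul_meas_ge_le_lintegral (μ := seedLaw)
      (f := fun ω => ENNReal.ofReal (Real.exp (S ω))) (by fun_prop)
      (ENNReal.ofReal (Real.exp x))
    have hmk' := hmk.trans hint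
    have hsub : seedLaw {ω | x < S ω} ≤ ENNReal.ofReal (Real.exp (-x)) := by
      calc seedLaw {ω | x < S ω}
          ≤ seedLaw {ω | ENNReal.ofReal (Real.exp x) ≤ ENNReal.ofReal (Real.exp (S ω))} := by
            refine measure_mono fun ω hω => ?_
            exact ENNReal.ofReal_le_ofReal (Real.exp_le_exp.2 (le_of_lt hω))
        _ ≤ (ENNReal.ofReal (Real.exp x))⁻¹ := by
            rw [ENNReal.le_inv_iff_mul_le, mul_comm]
            exact hmk'
        _ = ENNReal.ofReal (Real.exp (-x)) := by
            rw [Real.exp_neg, ENNReal.ofReal_inv_of_pos (Real.exp_pos x)]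
    exact ENNReal.toReal_le_of_le_ofReal (Real.exp_pos _).le hsub

/-! ### Exponential moments and the exponential weights forecaster -/

/-- A bounded random variable with mean at most `m` and second moment at most `v` has exponential
moment at most `exp (m + v)`. -/
theorem sum_mul_exp_le {ι : Type*} [Fintype ι] {ρ X : ι → ℝ} {m v : ℝ} (h0 : ∀ a, 0 ≤ ρ a)
    (h1 : ∑ a, ρ a = 1) (hX : ∀ a, |X a| ≤ 1) (hm : ∑ a, ρ a * X a ≤ m)
    (hv : ∑ a, ρ a * X a ^ 2 ≤ v) :
    ∑ a, ρ a * Real.exp (X a - (m + v)) ≤ 1 := by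
  have h : ∀ a, Real.exp (X a) ≤ 1 + X a + X a ^ 2 := fun a => by
    have := (abs_le.1 (Real.abs_exp_sub_one_sub_id_le (hX a))).2
    linarith
  have h2 : ∑ a, ρ a * Real.exp (X a) ≤ 1 + (m + v) := by
    calc ∑ a, ρ a * Real.exp (X a) ≤ ∑ a, (ρ a + ρ a * X a + ρ a * X a ^ 2) :=
          Finset.sum_le_sum fun a _ => by
            have := mul_le_mul_of_nonneg_left (h a) (h0 a)
            linarith
      _ ≤ 1 + (m + v) := by
          rw [Finset.sum_add_distrib, Finset.sum_add_distrib, h1]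
          linarith
  simp_rw [Real.exp_sub, ← mul_div_assoc]
  rw [← Finset.sum_div, div_le_one (Real.exp_pos _)]
  linarith [Real.add_one_le_exp (m + v)]

/-- The exponential weights for the cumulative gains `G`. -/
def expWeight {ι : Type*} [Fintype ι] (η : ℝ) (G : ι → ℝ) (i : ι) : ℝ :=
  Real.exp (η * G i) / ∑ k, Real.exp (η * G k)

section ExpWeight

variable {ι : Type*} [Fintype ι]

theorem expWeight_nonneg (η : ℝ) (G : ι → ℝ) (i : ι) : 0 ≤ expWeight η G i :=
  div_nonneg (Real.exp_pos _).le (Finset.sum_nonneg fun _ _ => (Real.exp_pos _).le)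

variable [Nonempty ι]

theorem sum_exp_pos (η : ℝ) (G : ι → ℝ) : 0 < ∑ k, Real.exp (η * G k) :=
  Finset.sum_pos (fun _ _ => Real.exp_pos _) Finset.univ_nonempty

theorem sum_expWeight (η : ℝ) (G : ι → ℝ) : ∑ i, expWeight η G i = 1 := by
  simp_rw [expWeight]
  rw [← Finset.sum_div, div_self (sum_exp_pos η G).ne']

/-- One step of exponential weights, with the log-sum-exp potential. -/
theorem log_sum_exp_add_le {η : ℝ} (G g : ι → ℝ) (hg : ∀ i, |η * g i| ≤ 1) :
    Real.log (∑ i, Real.exp (η * (g i + G i))) ≤ Real.log (∑ i, Real.exp (η * G i)) +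
      η * (∑ i, expWeight η G i * g i + η * ∑ i, expWeight η G i * g i ^ 2) := by
  have hpos := sum_exp_pos η G
  have e : ∑ i, Real.exp (η * (g i + G i)) =
      (∑ i, Real.exp (η * G i)) * ∑ i, expWeight η G i * Real.exp (η * g i) := by
    rw [Finset.mul_sum]
    refine Finset.sum_congr rfl fun i _ => ?_
    rw [mul_add, Real.exp_add, expWeight]
    field_simp
  have hle : ∑ i, expWeight η G i * Real.exp (η * g i) ≤
      1 + η * (∑ i, expWeight η G i * g i + η * ∑ i, expWeight η G i * g i ^ 2) := by
    calc _ ≤ ∑ i, (expWeight η G i + η * (expWeight η G i * g i) +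
          η * (η * (expWeight η G i * g i ^ 2))) := Finset.sum_le_sum fun i _ => by
            have h1 := (abs_le.1 (Real.abs_exp_sub_one_sub_id_le (hg i))).2
            have h2 := mul_le_mul_of_nonneg_left h1 (expWeight_nonneg η G i)
            linarith
      _ = _ := by
          simp_rw [Finset.sum_add_distrib, ← Finset.mul_sum, sum_expWeight]
          ring
  have hp : 0 < ∑ i, expWeight η G i * Real.exp (η * g i) :=
    Finset.sum_pos (fun i _ => mul_pos (div_pos (Real.exp_pos _) hpos) (Real.exp_pos _))
      Finset.univ_nonempty
  rw [e, Real.log_mul hpos.ne' hp.ne']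
  have := Real.log_le_sub_one_of_pos hp
  linarith

theorem le_log_sum_exp (η : ℝ) (G : ι → ℝ) (i : ι) :
    η * G i ≤ Real.log (∑ k, Real.exp (η * G k)) := by
  rw [Real.le_log_iff_exp_le (sum_exp_pos η G)]
  exact Finset.single_le_sum (f := fun k => Real.exp (η * G k))
    (fun _ _ => (Real.exp_pos _).le) (Finset.mem_univ i)

end ExpWeight

/-! ### Valuations rounded to a grid -/

theorem trade_grid {Q : ℕ} (hQ : 0 < Q) {s b : ℝ} (hb : 0 ≤ b) (k l : ℕ) :
    trade s b (k / Q) (l / Q) = decide (⌈s * Q⌉₊ ≤ k ∧ l ≤ ⌊b * Q⌋₊) := by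
  have hQ' : (0 : ℝ) < Q := by exact_mod_cast hQ
  unfold trade
  rw [decide_eq_decide, Nat.ceil_le, Nat.le_floor_iff (by positivity), le_div_iff₀ hQ',
    div_le_iff₀ hQ']

/-- The indicator of a trade at the grid prices `k`, `l`, for valuations rounded to `σ`, `τ`. -/
def bitVal (σ τ : ℕ) (x : ℕ × ℕ) : ℝ := if σ ≤ x.1 ∧ x.2 ≤ τ then 1 else 0

/-- The gain from trade at grid prices `x`, in terms of the rounded valuations. -/
def gridGain (Q σ τ : ℕ) (x : ℕ × ℕ) : ℝ := ((τ : ℝ) - σ) / Q * bitVal σ τ x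

theorem bitVal_nonneg (σ τ : ℕ) (x : ℕ × ℕ) : 0 ≤ bitVal σ τ x := by
  unfold bitVal; split_ifs <;> norm_num

theorem bitVal_le_one (σ τ : ℕ) (x : ℕ × ℕ) : bitVal σ τ x ≤ 1 := by
  unfold bitVal; split_ifs <;> norm_num

theorem sum_fin_ite_lt {Q m : ℕ} (hm : m ≤ Q) :
    ∑ u : Fin Q, (if (u : ℕ) < m then (1 : ℝ) else 0) = m := by
  rw [Fin.sum_univ_eq_sum_range (fun u => if u < m then (1 : ℝ) else 0), ← Finset.sum_filter]
  have : (Finset.range Q).filter (fun u => u < m) = Finset.range m := by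
    ext u; simp; omega
  rw [this]; simp

/-- Varying the buyer's price over the grid, but never below `l`, averages the trade indicator to
the buyer's valuation on the event of a trade at `(k, l)`; no price pair of the sum overpays by
more than `k - l`. -/
theorem sum_bitVal_buyer {Q σ τ k l : ℕ} (hτ : τ ≤ Q) :
    ∑ u : Fin Q, bitVal σ τ (k, max (u + 1) l) = τ * bitVal σ τ (k, l) := by
  unfold bitVal
  by_cases h : σ ≤ k ∧ l ≤ τ
  · rw [if_pos h, mul_one, ← sum_fin_ite_lt hτ]
    refine Finset.sum_congr rfl fun u _ => if_congr ?_ rfl rfl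
    simp only [h.1, true_and, max_le_iff, h.2, and_true]
    omega
  · rw [if_neg h, mul_zero]
    refine Finset.sum_eq_zero fun u _ => if_neg fun h' => h ⟨h'.1, (le_max_right _ _).trans h'.2⟩

/-- The analogue for the seller's price, kept at most `k`: the average is one minus the seller's
valuation. -/
theorem sum_bitVal_seller {Q σ τ k l : ℕ} (hσ : σ ≤ Q) :
    ∑ u : Fin Q, bitVal σ τ (min u k, l) = ((Q : ℝ) - σ) * bitVal σ τ (k, l) := by
  unfold bitVal
  by_cases h : σ ≤ k ∧ l ≤ τ
  · have e : ∀ u : Fin Q, (if σ ≤ min (u : ℕ) k ∧ l ≤ τ then (1 : ℝ) else 0) =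
        1 - if (u : ℕ) < σ then 1 else 0 := fun u => by
      by_cases hu : (u : ℕ) < σ
      · rw [if_pos hu, if_neg (by omega)]; norm_num
      · rw [if_neg hu, if_pos (by omega)]; norm_num
    simp only [if_pos h, mul_one]
    rw [Finset.sum_congr rfl fun u _ => e u, Finset.sum_sub_distrib, sum_fin_ite_lt hσ]
    simp
  · rw [if_neg h, mul_zero]
    refine Finset.sum_eq_zero fun u _ => if_neg fun h' => h ⟨h'.1.trans (min_le_right _ _), h'.2⟩

section Round

variable {Q : ℕ} {s b : ℝ}

theorem ceil_mul_le (hs : s ∈ Set.Icc (0 : ℝ) 1) : ⌈s * Q⌉₊ ≤ Q :=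
  Nat.ceil_le.2 (mul_le_of_le_one_left (Nat.cast_nonneg _) hs.2)

theorem floor_mul_le (hb : b ∈ Set.Icc (0 : ℝ) 1) : ⌊b * Q⌋₊ ≤ Q :=
  Nat.floor_le_of_le (mul_le_of_le_one_left (Nat.cast_nonneg _) hb.2)

theorem abs_gft_le_one (hs : s ∈ Set.Icc (0 : ℝ) 1) (hb : b ∈ Set.Icc (0 : ℝ) 1) (p q : ℝ) :
    |gft s b p q| ≤ 1 := by
  unfold gft
  split_ifs
  · exact abs_le.2 ⟨by linarith [hs.2, hb.1], by linarith [hs.1, hb.2]⟩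
  · simp

/-- Rounding the valuations inwards can only decrease the gain from trade. -/
theorem gridGain_le_gft (hQ : 0 < Q) (hb : b ∈ Set.Icc (0 : ℝ) 1) (x : ℕ × ℕ)
    : gridGain Q ⌈s * Q⌉₊ ⌊b * Q⌋₊ x ≤ gft s b (x.1 / Q) (x.2 / Q) := by
  have hQ' : (0 : ℝ) < Q := by exact_mod_cast hQ
  unfold gft gridGain bitVal
  rw [trade_grid hQ hb.1]
  by_cases h : ⌈s * Q⌉₊ ≤ x.1 ∧ x.2 ≤ ⌊b * Q⌋₊
  · simp only [h, and_self, if_true, decide_true, mul_one]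
    rw [div_le_iff₀ hQ']
    have h1 := Nat.le_ceil (s * Q)
    have h2 := Nat.floor_le (mul_nonneg hb.1 hQ'.le)
    linarith
  · rw [decide_eq_false h, if_neg h]
    simp

/-- Replacing a single price `p` by the end points of a grid interval `[l, k] / Q` around it loses
at most the rounding error, unless both valuations fall into that interval in the wrong order. -/
theorem gft_le_gridGain_add (hQ : 0 < Q) (hs : s ∈ Set.Icc (0 : ℝ) 1)
    {p : ℝ} {k l : ℕ} (hl : l ≤ p * Q) (hk : p * Q ≤ k) :
    gft s b p p ≤ gridGain Q ⌈s * Q⌉₊ ⌊b * Q⌋₊ (k, l) + 2 / Q +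
      if l ≤ ⌊b * Q⌋₊ ∧ ⌊b * Q⌋₊ < k ∧ l < ⌈s * Q⌉₊ ∧ ⌈s * Q⌉₊ ≤ k then ((k : ℝ) - l) / Q
      else 0 := by
  have hQ' : (0 : ℝ) < Q := by exact_mod_cast hQ
  have h1 := Nat.ceil_lt_add_one (mul_nonneg hs.1 hQ'.le)
  have h2 := Nat.lt_floor_add_one (b * Q)
  set σ := ⌈s * Q⌉₊ with hσ
  set τ := ⌊b * Q⌋₊ with hτ
  have hkl : (0 : ℝ) ≤ ((k : ℝ) - l) / Q := div_nonneg (by linarith) hQ'.le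
  have hite : (0 : ℝ) ≤ if l ≤ τ ∧ τ < k ∧ l < σ ∧ σ ≤ k then ((k : ℝ) - l) / Q else 0 := by
    split_ifs <;> linarith
  have h2Q : (0 : ℝ) ≤ 2 / Q := by positivity
  by_cases hp : s ≤ p ∧ p ≤ b
  · have e : gft s b p p = b - s := by simp [gft, trade, hp]
    have hσk : σ ≤ k := Nat.ceil_le.2 ((mul_le_mul_of_nonneg_right hp.1 hQ'.le).trans hk)
    have hlτ : l ≤ τ := Nat.le_floor (hl.trans (mul_le_mul_of_nonneg_right hp.2 hQ'.le))
    have hg : gridGain Q σ τ (k, l) = ((τ : ℝ) - σ) / Q := by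
      simp [gridGain, bitVal, hσk, hlτ]
    have : b - s ≤ ((τ : ℝ) - σ) / Q + 2 / Q := by
      rw [← add_div, le_div_iff₀ hQ']
      linarith
    rw [e, hg]
    linarith
  · have e : gft s b p p = 0 := by simp [gft, trade, hp]
    rw [e]
    by_cases ht : σ ≤ k ∧ l ≤ τ
    · have hg : gridGain Q σ τ (k, l) = ((τ : ℝ) - σ) / Q := by
        simp [gridGain, bitVal, ht]
      rw [hg]
      by_cases hst : σ ≤ τ
      · have : (0 : ℝ) ≤ ((τ : ℝ) - σ) / Q :=
          div_nonneg (sub_nonneg.2 (by exact_mod_cast hst)) hQ'.le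
        linarith
      · rw [if_pos ⟨ht.2, by omega, by omega, ht.1⟩]
        have h3 : (σ : ℝ) ≤ k := by exact_mod_cast ht.1
        have h4 : (l : ℝ) ≤ τ := by exact_mod_cast ht.2
        have : (0 : ℝ) ≤ ((τ : ℝ) - σ) / Q + ((k : ℝ) - l) / Q := by
          rw [← add_div]
          exact div_nonneg (by linarith) hQ'.le
        linarith
    · have hg : gridGain Q σ τ (k, l) = 0 := by simp [gridGain, bitVal, ht]
      rw [hg]
      linarith

end Round

/-! ### Adaptive partitions into dyadic intervals -/

/-- The cells of the finest partition: the experts of the learner. The cell `i` stands for the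
interval of prices `[i, i + 1] / (2 ^ a * 2 ^ a)`. -/
abbrev Cell (a : ℕ) := Fin (2 ^ a * 2 ^ a)

/-- The blocks of the coarsest partition, each made of `2 ^ a` consecutive cells. -/
abbrev Block (a : ℕ) := Fin (2 ^ a)

variable {a : ℕ}

/-- The block that contains a cell. -/
def block (i : Cell a) : Block a := ⟨i / 2 ^ a, Nat.div_lt_of_lt_mul i.2⟩

/-- The number of cells of the leaf that contains `i`, when each block `j` is split into
`2 ^ lev j` leaves of equal width. -/
def width (lev : Block a → ℕ) (i : Cell a) : ℕ := 2 ^ (a - lev (block i))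

/-- The first cell of the leaf that contains `i`; it serves as the name of that leaf. -/
def leaf (lev : Block a → ℕ) (i : Cell a) : Cell a :=
  ⟨i / width lev i * width lev i, (Nat.div_mul_le_self _ _).trans_lt i.2⟩

/-- The prices of the expert `i` on the grid of multiples of `1 / (2 ^ a * 2 ^ a)`: the seller gets
the upper end of the leaf that contains `i`, the buyer the lower end. -/
def leafPrices (lev : Block a → ℕ) (i : Cell a) : ℕ × ℕ :=
  (leaf lev i + width lev i, leaf lev i)

/-- The leaves of the partition with levels `lev`. -/
def leaves (lev : Block a → ℕ) : Finset (Cell a) := Finset.univ.filter fun i => leaf lev i = i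

theorem width_pos (lev : Block a → ℕ) (i : Cell a) : 0 < width lev i := by
  unfold width; positivity

theorem width_dvd (lev : Block a → ℕ) (i : Cell a) : width lev i ∣ 2 ^ a :=
  pow_dvd_pow 2 (Nat.sub_le _ _)

theorem leaf_le (lev : Block a → ℕ) (i : Cell a) : (leaf lev i : ℕ) ≤ i :=
  Nat.div_mul_le_self _ _

theorem lt_leaf_add_width (lev : Block a → ℕ) (i : Cell a) :
    (i : ℕ) < leaf lev i + width lev i := by
  have := Nat.lt_div_mul_add (a := i) (width_pos lev i)
  exact this

theorem block_mul_le_leaf (lev : Block a → ℕ) (i : Cell a) :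
    (block i : ℕ) * 2 ^ a ≤ leaf lev i := by
  obtain ⟨d, hd⟩ := width_dvd lev i
  have h : (i : ℕ) / 2 ^ a * 2 ^ a ≤ i := Nat.div_mul_le_self _ _
  have h2 : (i : ℕ) / 2 ^ a * d * width lev i ≤ i := by
    calc _ = (i : ℕ) / 2 ^ a * (width lev i * d) := by ring
      _ ≤ i := by rw [← hd]; exact h
  calc (block i : ℕ) * 2 ^ a = (i : ℕ) / 2 ^ a * (width lev i * d) :=
        congrArg ((i : ℕ) / 2 ^ a * ·) hd
    _ = (i : ℕ) / 2 ^ a * d * width lev i := by ring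
    _ ≤ (i : ℕ) / width lev i * width lev i :=
        Nat.mul_le_mul_right _ ((Nat.le_div_iff_mul_le (width_pos lev i)).2 h2)

theorem leaf_add_width_le (lev : Block a → ℕ) (i : Cell a) :
    (leaf lev i : ℕ) + width lev i ≤ (block i + 1) * 2 ^ a := by
  obtain ⟨d, hd⟩ := width_dvd lev i
  have h : (i : ℕ) < ((i : ℕ) / 2 ^ a + 1) * 2 ^ a := by
    rw [add_one_mul]; exact Nat.lt_div_mul_add (by positivity)
  have h2 : (i : ℕ) / width lev i < ((i : ℕ) / 2 ^ a + 1) * d := by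
    rw [Nat.div_lt_iff_lt_mul (width_pos lev i)]
    calc (i : ℕ) < ((i : ℕ) / 2 ^ a + 1) * (width lev i * d) := by rw [← hd]; exact h
      _ = _ := by ring
  calc (leaf lev i : ℕ) + width lev i = ((i : ℕ) / width lev i + 1) * width lev i := by
        change (i : ℕ) / width lev i * width lev i + width lev i = _
        ring
    _ ≤ ((i : ℕ) / 2 ^ a + 1) * d * width lev i := Nat.mul_le_mul_right _ h2
    _ = ((i : ℕ) / 2 ^ a + 1) * (width lev i * d) := by ring
    _ = (block i + 1) * 2 ^ a := congrArg (((i : ℕ) / 2 ^ a + 1) * ·) hd.symm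

theorem block_leaf (lev : Block a → ℕ) (i : Cell a) : block (leaf lev i) = block i := by
  apply Fin.ext
  change (leaf lev i : ℕ) / 2 ^ a = block i
  refine Nat.div_eq_of_lt_le (block_mul_le_leaf lev i) ?_
  have := leaf_add_width_le lev i
  have := width_pos lev i
  omega

theorem width_leaf (lev : Block a → ℕ) (i : Cell a) : width lev (leaf lev i) = width lev i := by
  unfold width; rw [block_leaf]

theorem leaf_leaf (lev : Block a → ℕ) (i : Cell a) : leaf lev (leaf lev i) = leaf lev i := by
  apply Fin.ext
  change (leaf lev i : ℕ) / width lev (leaf lev i) * width lev (leaf lev i) = leaf lev i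
  rw [width_leaf]
  exact Nat.div_mul_cancel (Dvd.intro_left _ rfl)

theorem leafPrices_leaf (lev : Block a → ℕ) (i : Cell a) :
    leafPrices lev (leaf lev i) = leafPrices lev i := by
  unfold leafPrices
  rw [leaf_leaf, width_leaf]

theorem block_add_one_mul_le (j : Block a) : ((j : ℕ) + 1) * 2 ^ a ≤ 2 ^ a * 2 ^ a :=
  Nat.mul_le_mul_right _ j.2

/-- The number of leaves is at most the sum of the numbers of parts of the blocks. -/
theorem card_leaves_le (lev : Block a → ℕ) (h : ∀ j, lev j ≤ a) :
    (leaves lev).card ≤ ∑ j, 2 ^ lev j := by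
  rw [Finset.card_eq_sum_card_fiberwise (f := block) (t := Finset.univ) (by simp)]
  refine Finset.sum_le_sum fun j _ => ?_
  have hw : 2 ^ a = 2 ^ lev j * 2 ^ (a - lev j) := by rw [← pow_add, Nat.add_sub_cancel' (h j)]
  rw [← Finset.card_range (2 ^ lev j)]
  refine Finset.card_le_card_of_injOn (fun i => (i : ℕ) / 2 ^ (a - lev j) - j * 2 ^ lev j) ?_ ?_
  · intro i hi
    simp only [leaves, Finset.coe_filter, Finset.mem_filter, Finset.mem_univ, true_and,
      Set.mem_ofPred_eq] at hi
    have h1 := lt_leaf_add_width lev i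
    have h2 := leaf_add_width_le lev i
    rw [hi.2] at h2
    have h3 : (i : ℕ) < ((j : ℕ) + 1) * 2 ^ lev j * 2 ^ (a - lev j) := by
      rw [mul_assoc, ← hw]; omega
    have h5 := width_pos lev i
    have h4 := (Nat.div_lt_iff_lt_mul (by positivity)).2 h3
    simp only [Finset.coe_range, Set.mem_Iio]
    have : ((j : ℕ) + 1) * 2 ^ lev j = j * 2 ^ lev j + 2 ^ lev j := by ring
    have : 0 < 2 ^ lev j := by positivity
    omega
  · have key : ∀ i ∈ ((leaves lev).filter fun i => block i = j : Set (Cell a)),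
        (j : ℕ) * 2 ^ lev j ≤ i / 2 ^ (a - lev j) ∧
          (i : ℕ) = i / 2 ^ (a - lev j) * 2 ^ (a - lev j) := by
      intro i hi
      simp only [leaves, Finset.coe_filter, Finset.mem_filter, Finset.mem_univ, true_and,
        Set.mem_ofPred_eq] at hi
      constructor
      · rw [Nat.le_div_iff_mul_le (by positivity), mul_assoc, ← hw, ← hi.2]
        exact (block_mul_le_leaf lev i).trans (leaf_le lev i)
      · have := congrArg Fin.val hi.1
        change (i : ℕ) / width lev i * width lev i = i at this
        rw [width, hi.2] at this
        exact this.symm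
    intro i hi i' hi' hii
    have k1 := key i hi
    have k2 := key i' hi'
    have e : (i : ℕ) / 2 ^ (a - lev j) = i' / 2 ^ (a - lev j) := by
      dsimp only at hii
      omega
    apply Fin.ext
    rw [k1.2, k2.2, e]

/-! ### Actions, estimators and the policy -/

/-- The actions: to play an expert; to probe the gain of a leaf, in one of three ways and with an
auxiliary price; to probe whether both valuations lie in a block, with one of four pairs of
end points. -/
abbrev Action (a : ℕ) := Cell a ⊕ (Cell a × Fin 3 × Cell a) ⊕ (Block a × Bool × Bool)

/-- The prices of the three kinds of probes of the gain at the prices `x`: with the auxiliary price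
`u` for the buyer, for the seller, or for neither. -/
def probePrices (x : ℕ × ℕ) (c : Fin 3) (u : ℕ) : ℕ × ℕ :=
  if c = 0 then (x.1, max (u + 1) x.2) else if c = 1 then (min u x.1, x.2) else x

/-- The signs with which the three kinds of probes enter the estimate of the gain `b - s`, read as
`b + (1 - s) - 1`. -/
def probeSign (c : Fin 3) : ℝ := if c = 2 then -1 else 1

/-- The prices of the probes of the block `j`: `e` and `f` select an end point of the block for the
seller and for the buyer, the more permissive one if `true`. -/
def countPrices (j : Block a) (e f : Bool) : ℕ × ℕ :=
  (if e then (j + 1) * 2 ^ a else j * 2 ^ a, if f then j * 2 ^ a else (j + 1) * 2 ^ a)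

/-- The signs with which the probes of a block enter the estimate. -/
def countSign (e f : Bool) : ℝ := (if e then 1 else -1) * (if f then 1 else -1)

/-- The grid prices posted by an action under the partition with levels `lev`. -/
def actionPrices (lev : Block a → ℕ) : Action a → ℕ × ℕ
  | .inl i => leafPrices lev i
  | .inr (.inl (i, c, u)) => probePrices (leafPrices lev i) c u
  | .inr (.inr (j, e, f)) => countPrices j e f

/-- Every action overpays by at most the width of a block. -/
theorem actionPrices_fst_le (lev : Block a → ℕ) (x : Action a) :
    (actionPrices lev x).1 ≤ (actionPrices lev x).2 + 2 ^ a := by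
  have hw : ∀ i, width lev i ≤ 2 ^ a := fun i => Nat.le_of_dvd (by positivity) (width_dvd lev i)
  rcases x with i | ⟨i, c, u⟩ | ⟨j, e, f⟩
  · have := hw i
    simp only [actionPrices, leafPrices]
    omega
  · have := hw i
    simp only [actionPrices, leafPrices, probePrices]
    split_ifs <;> simp <;> omega
  · have : 0 < 2 ^ a := by positivity
    simp only [actionPrices, countPrices, add_one_mul]
    split_ifs <;> omega

theorem leafPrices_fst_le (lev : Block a → ℕ) (i : Cell a) :
    (leafPrices lev i).1 ≤ 2 ^ a * 2 ^ a :=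
  (leaf_add_width_le lev i).trans (block_add_one_mul_le _)

theorem actionPrices_le (lev : Block a → ℕ) (x : Action a) :
    (actionPrices lev x).1 ≤ 2 ^ a * 2 ^ a ∧ (actionPrices lev x).2 ≤ 2 ^ a * 2 ^ a := by
  rcases x with i | ⟨i, c, u⟩ | ⟨j, e, f⟩
  · exact ⟨leafPrices_fst_le lev i, (leaf lev i).2.le⟩
  · have h1 := leafPrices_fst_le lev i
    have h2 : (leafPrices lev i).2 ≤ 2 ^ a * 2 ^ a := (leaf lev i).2.le
    have h3 := u.2
    simp only [actionPrices, probePrices]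
    split_ifs
    · exact ⟨h1, max_le h3 h2⟩
    · exact ⟨(min_le_right _ _).trans h1, h2⟩
    · exact ⟨h1, h2⟩
  · have h1 := block_add_one_mul_le j
    have h2 : (j : ℕ) * 2 ^ a ≤ (j + 1) * 2 ^ a := Nat.mul_le_mul_right _ (Nat.le_succ _)
    simp only [actionPrices, countPrices]
    constructor <;> split_ifs <;> omega

/-- The importance weighted estimate of the gain of the expert `i'` from the bit `v` observed
after the action. The weight is the inverse of the probability `γ / (18 * 2 ^ a)` with which
`mixture` probes a given leaf in a given one of the three ways. -/
def gainEst (γ : ℝ) (lev : Block a → ℕ) (x : Action a) (v : ℝ) (i' : Cell a) : ℝ :=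
  match x with
  | .inr (.inl (i, c, _)) => if leaf lev i' = i then 18 * 2 ^ a / γ * (probeSign c * v) else 0
  | _ => 0

/-- The importance weighted estimate of the indicator that both valuations lie in the block `j'`,
from the bit `v` observed after the action. -/
def countEst (γ : ℝ) (x : Action a) (v : ℝ) (j' : Block a) : ℝ :=
  match x with
  | .inr (.inr (j, e, f)) => if j = j' then 4 * 2 ^ a / γ * (countSign e f * v) else 0
  | _ => 0

/-- The mixed action: probe each leaf with probability `γ / (6 * 2 ^ a)` and each block with
probability `γ / 2 ^ a`, and otherwise play an expert drawn from `w`. The probability of probing a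
leaf does not depend on the number of leaves, which keeps the second moments of the estimates
bounded; this presupposes that there are at most `6 * 2 ^ a` leaves. -/
def mixture (γ : ℝ) (lev : Block a → ℕ) (w : Cell a → ℝ) : Action a → ℝ
  | .inl i => (1 - γ - γ * ((leaves lev).card / (6 * 2 ^ a))) * w i
  | .inr (.inl (i, _, _)) => if leaf lev i = i then γ / (6 * 2 ^ a) / (3 * (2 ^ a * 2 ^ a)) else 0
  | .inr (.inr _) => γ / (4 * 2 ^ a)

section Mixture

variable {γ : ℝ} {lev : Block a → ℕ} {w : Cell a → ℝ}

theorem sum_mixture_mul (F : Action a → ℝ) :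
    ∑ x, mixture γ lev w x * F x =
      (1 - γ - γ * ((leaves lev).card / (6 * 2 ^ a))) * ∑ i, w i * F (.inl i) +
      (γ / (6 * 2 ^ a) / (3 * (2 ^ a * 2 ^ a)) *
          ∑ i ∈ leaves lev, ∑ c, ∑ u, F (.inr (.inl (i, c, u))) +
        γ / (4 * 2 ^ a) * ∑ j, ∑ e, ∑ f, F (.inr (.inr (j, e, f)))) := by
  simp only [Fintype.sum_sum_type, Fintype.sum_prod_type, mixture, leaves, Finset.sum_filter,
    Finset.mul_sum]
  congr 1
  · exact Finset.sum_congr rfl fun i _ => by ring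
  · congr 1
    refine Finset.sum_congr rfl fun i _ => ?_
    split_ifs <;> simp [Finset.mul_sum]

theorem probe_leaves_prob_le (hγ : 0 < γ) (hcard : (leaves lev).card ≤ 6 * 2 ^ a) :
    γ * ((leaves lev).card / (6 * 2 ^ a) : ℝ) ≤ γ := by
  refine mul_le_of_le_one_right hγ.le ?_
  rw [div_le_one (by positivity)]
  exact_mod_cast hcard

theorem mixture_nonneg (hγ : 0 < γ) (hγ2 : γ ≤ 1 / 2) (hcard : (leaves lev).card ≤ 6 * 2 ^ a)
    (hw : ∀ i, 0 ≤ w i) (x : Action a) : 0 ≤ mixture γ lev w x := by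
  have := probe_leaves_prob_le hγ hcard
  rcases x with i | ⟨i, c, u⟩ | ⟨j, e, f⟩
  · exact mul_nonneg (by linarith) (hw i)
  · simp only [mixture]
    split_ifs <;> positivity
  · simp only [mixture]
    positivity

theorem sum_mixture (hw1 : ∑ i, w i = 1) : ∑ x, mixture γ lev w x = 1 := by
  have h := sum_mixture_mul (γ := γ) (lev := lev) (w := w) fun _ => 1
  simp only [mul_one] at h
  rw [h, hw1]
  simp
  field_simp
  ring

/-- Expectation of a function of the probes of a single leaf. -/
theorem sum_mixture_probe (i' : Cell a) (F : Action a → ℝ) (h : Fin 3 → Cell a → ℝ)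
    (h1 : ∀ i, F (.inl i) = 0) (h3 : ∀ y, F (.inr (.inr y)) = 0)
    (h2 : ∀ i c u, F (.inr (.inl (i, c, u))) = if leaf lev i' = i then h c u else 0) :
    ∑ x, mixture γ lev w x * F x =
      γ / (6 * 2 ^ a) / (3 * (2 ^ a * 2 ^ a)) * ∑ c, ∑ u, h c u := by
  rw [sum_mixture_mul]
  simp only [h1, h2, h3, mul_zero, Finset.sum_const_zero, zero_add, add_zero]
  congr 1
  rw [Finset.sum_eq_single (leaf lev i')]
  · simp
  · intro i _ hi
    simp [hi.symm]
  · intro hi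
    simp [leaves, leaf_leaf] at hi

/-- The estimate of the gain of an expert is unbiased. -/
theorem sum_mixture_gainEst (hγ : 0 < γ) {σ τ : ℕ} (hσ : σ ≤ 2 ^ a * 2 ^ a)
    (hτ : τ ≤ 2 ^ a * 2 ^ a) (i' : Cell a) :
    ∑ x, mixture γ lev w x * gainEst γ lev x (bitVal σ τ (actionPrices lev x)) i' =
      gridGain (2 ^ a * 2 ^ a) σ τ (leafPrices lev i') := by
  rw [sum_mixture_probe i' _ (fun c u => 18 * 2 ^ a / γ *
    (probeSign c * bitVal σ τ (probePrices (leafPrices lev i') c u))) (fun _ => rfl)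
    (fun _ => rfl)]
  · simp_rw [← Finset.mul_sum]
    rw [Fin.sum_univ_three]
    have e0 : ∀ u, probePrices (leafPrices lev i') 0 u =
      ((leafPrices lev i').1, max (u + 1) (leafPrices lev i').2) := fun u => rfl
    have e1 : ∀ u, probePrices (leafPrices lev i') 1 u =
      (min u (leafPrices lev i').1, (leafPrices lev i').2) := fun u => rfl
    have e2 : ∀ u, probePrices (leafPrices lev i') 2 u = leafPrices lev i' := fun u => rfl
    have s0 : probeSign 0 = 1 := rfl
    have s1 : probeSign 1 = 1 := rfl
    have s2 : probeSign 2 = -1 := rfl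
    simp only [e0, e1, e2, s0, s1, s2]
    rw [sum_bitVal_buyer hτ, sum_bitVal_seller hσ]
    simp only [Finset.sum_const, Finset.card_univ, Fintype.card_fin, nsmul_eq_mul, gridGain]
    push_cast
    field_simp
    ring
  · intro i c u
    simp only [gainEst, actionPrices]
    split_ifs with h
    · rw [← h, leafPrices_leaf]
    · rfl

theorem abs_gainEst_le (hγ : 0 < γ) (x : Action a) {v : ℝ} (hv0 : 0 ≤ v) (hv1 : v ≤ 1)
    (i' : Cell a) : |gainEst γ lev x v i'| ≤ 18 * 2 ^ a / γ := by
  have hB : (0 : ℝ) ≤ 18 * 2 ^ a / γ := by positivity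
  rcases x with i | ⟨i, c, u⟩ | y
  · simpa [gainEst] using hB
  · simp only [gainEst]
    split_ifs
    · rw [abs_mul, abs_mul, abs_of_nonneg hB, abs_of_nonneg hv0]
      have : |probeSign c| = 1 := by unfold probeSign; split_ifs <;> simp
      rw [this, one_mul]
      exact mul_le_of_le_one_right hB hv1
    · simpa using hB
  · simpa [gainEst] using hB

theorem sum_mixture_gainEst_sq_le (hγ : 0 < γ) {v : Action a → ℝ} (hv0 : ∀ x, 0 ≤ v x)
    (hv1 : ∀ x, v x ≤ 1) (i' : Cell a) :
    ∑ x, mixture γ lev w x * gainEst γ lev x (v x) i' ^ 2 ≤ 54 * 2 ^ a / γ := by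
  rw [sum_mixture_probe i' _ (fun c u =>
    gainEst γ lev (.inr (.inl (leaf lev i', c, u))) (v (.inr (.inl (leaf lev i', c, u)))) i' ^ 2)
    (fun _ => by simp [gainEst]) (fun _ => by simp [gainEst])]
  · calc _ ≤ γ / (6 * 2 ^ a) / (3 * (2 ^ a * 2 ^ a)) *
          ∑ c : Fin 3, ∑ u : Cell a, (18 * 2 ^ a / γ) ^ 2 := by
          refine mul_le_mul_of_nonneg_left (Finset.sum_le_sum fun c _ =>
            Finset.sum_le_sum fun u _ => ?_) (by positivity)
          rw [← sq_abs]
          gcongr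
          exact abs_gainEst_le hγ _ (hv0 _) (hv1 _) i'
      _ = 54 * 2 ^ a / γ := by
          simp only [Finset.sum_const, Finset.card_univ, Fintype.card_fin, nsmul_eq_mul]
          push_cast
          field_simp
          ring
  · intro i c u
    split_ifs with h
    · rw [h]
    · simp [gainEst, h]

/-- The indicator that both rounded valuations lie in the block `j`, the seller's not at the lower
end and the buyer's not at the upper end. -/
def inBlock (σ τ : ℕ) (j : Block a) : ℝ :=
  if (j * 2 ^ a ≤ τ ∧ τ < (j + 1) * 2 ^ a) ∧ (j * 2 ^ a < σ ∧ σ ≤ (j + 1) * 2 ^ a) then 1 else 0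

/-- Inclusion and exclusion for the indicator that the seller's valuation lies in `(L, R]` and the
buyer's in `[L, R)`. -/
theorem inclusion_exclusion_interval (σ τ : ℕ) {L R : ℕ} (h : L < R) :
    (1 * 1 * (if σ ≤ R ∧ L ≤ τ then (1 : ℝ) else 0) +
        1 * -1 * (if σ ≤ R ∧ R ≤ τ then (1 : ℝ) else 0)) +
      (-1 * 1 * (if σ ≤ L ∧ L ≤ τ then (1 : ℝ) else 0) +
        -1 * -1 * (if σ ≤ L ∧ R ≤ τ then (1 : ℝ) else 0)) =
      if (L ≤ τ ∧ τ < R) ∧ (L < σ ∧ σ ≤ R) then 1 else 0 := by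
  split_ifs <;> first | omega | norm_num

/-- The estimate of the indicator of a block is unbiased. -/
theorem sum_mixture_countEst (hγ : 0 < γ) (σ τ : ℕ) (j' : Block a) :
    ∑ x, mixture γ lev w x * countEst γ x (bitVal σ τ (actionPrices lev x)) j' =
      inBlock σ τ j' := by
  rw [sum_mixture_mul]
  simp only [countEst, mul_zero, Finset.sum_const_zero, zero_add, actionPrices]
  rw [Finset.sum_eq_single j' (fun j _ hj => by simp [hj]) (by simp)]
  have hlt : (j' : ℕ) * 2 ^ a < (j' + 1) * 2 ^ a :=
    Nat.mul_lt_mul_of_pos_right (Nat.lt_succ_self _) (by positivity)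
  have e : ∑ e : Bool, ∑ f : Bool, countSign e f * bitVal σ τ (countPrices j' e f) =
      inBlock σ τ j' := by
    simp only [Fintype.sum_bool, countSign, countPrices, bitVal, inBlock, if_true,
      Bool.false_eq_true, if_false]
    exact inclusion_exclusion_interval σ τ hlt
  simp only [if_true, ← Finset.mul_sum]
  rw [e]
  field_simp

theorem abs_countEst_le (hγ : 0 < γ) (x : Action a) {v : ℝ} (hv0 : 0 ≤ v) (hv1 : v ≤ 1)
    (j' : Block a) : |countEst γ x v j'| ≤ 4 * 2 ^ a / γ := by
  have hB : (0 : ℝ) ≤ 4 * 2 ^ a / γ := by positivity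
  rcases x with i | y | ⟨j, e, f⟩
  · simpa [countEst] using hB
  · simpa [countEst] using hB
  · simp only [countEst]
    split_ifs
    · rw [abs_mul, abs_mul, abs_of_nonneg hB, abs_of_nonneg hv0]
      have : |countSign e f| = 1 := by cases e <;> cases f <;> simp [countSign]
      rw [this, one_mul]
      exact mul_le_of_le_one_right hB hv1
    · simpa using hB

theorem sum_mixture_countEst_sq_le (hγ : 0 < γ) {v : Action a → ℝ} (hv0 : ∀ x, 0 ≤ v x)
    (hv1 : ∀ x, v x ≤ 1) (j' : Block a) :
    ∑ x, mixture γ lev w x * countEst γ x (v x) j' ^ 2 ≤ 16 * 2 ^ a / γ := by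
  rw [sum_mixture_mul]
  have z1 : ∀ i, countEst γ (.inl i) (v (.inl i)) j' = 0 := fun _ => rfl
  have z2 : ∀ y, countEst γ (.inr (.inl y)) (v (.inr (.inl y))) j' = 0 := fun _ => rfl
  simp only [z1, z2, ne_eq, OfNat.ofNat_ne_zero, not_false_eq_true, zero_pow, mul_zero,
    Finset.sum_const_zero, zero_add]
  rw [Finset.sum_eq_single j' (fun j _ hj => by simp [countEst, hj]) (by simp)]
  calc _ ≤ γ / (4 * 2 ^ a) * ∑ e : Bool, ∑ f : Bool, (4 * 2 ^ a / γ) ^ 2 := by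
        refine mul_le_mul_of_nonneg_left (Finset.sum_le_sum fun e _ =>
          Finset.sum_le_sum fun f _ => ?_) (by positivity)
        rw [← sq_abs]
        gcongr
        exact abs_countEst_le hγ _ (hv0 _) (hv1 _) j'
    _ = 16 * 2 ^ a / γ := by
        simp only [Fintype.sum_bool]
        field_simp
        ring

end Mixture

/-! ### Conditional exponential moments of one round -/

section RoundTerm

variable {γ η : ℝ} {lev : Block a → ℕ} {w : Cell a → ℝ}

/-- The probes contribute at most their probability to the mean of a function bounded by `1`. -/
theorem sum_mixture_mul_le (hγ : 0 < γ) {F : Action a → ℝ}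
    (hF : ∀ x, F x ≤ 1) :
    ∑ x, mixture γ lev w x * F x ≤
      (1 - γ - γ * ((leaves lev).card / (6 * 2 ^ a))) * ∑ i, w i * F (.inl i) +
        (γ + γ * ((leaves lev).card / (6 * 2 ^ a))) := by
  rw [sum_mixture_mul]
  have h1 : ∑ i ∈ leaves lev, ∑ c : Fin 3, ∑ u : Cell a, F (.inr (.inl (i, c, u))) ≤
      ∑ i ∈ leaves lev, ∑ c : Fin 3, ∑ u : Cell a, (1 : ℝ) :=
    Finset.sum_le_sum fun _ _ => Finset.sum_le_sum fun _ _ => Finset.sum_le_sum fun _ _ => hF _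
  have h2 : ∑ j : Block a, ∑ e : Bool, ∑ f : Bool, F (.inr (.inr (j, e, f))) ≤
      ∑ j : Block a, ∑ e : Bool, ∑ f : Bool, (1 : ℝ) :=
    Finset.sum_le_sum fun _ _ => Finset.sum_le_sum fun _ _ => Finset.sum_le_sum fun _ _ => hF _
  have h1' := mul_le_mul_of_nonneg_left h1
    (show 0 ≤ γ / (6 * 2 ^ a) / (3 * (2 ^ a * 2 ^ a)) by positivity)
  have h2' := mul_le_mul_of_nonneg_left h2 (show 0 ≤ γ / (4 * 2 ^ a) by positivity)
  have e1 : γ / (6 * 2 ^ a) / (3 * (2 ^ a * 2 ^ a)) *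
      ∑ i ∈ leaves lev, ∑ c : Fin 3, ∑ u : Cell a, (1 : ℝ) =
      γ * ((leaves lev).card / (6 * 2 ^ a)) := by
    simp
    field_simp
  have e2 : γ / (4 * 2 ^ a) * ∑ j : Block a, ∑ e : Bool, ∑ f : Bool, (1 : ℝ) = γ := by
    simp
    field_simp
    norm_num
  rw [e1] at h1'
  rw [e2] at h2'
  linarith

theorem sum_mixture_mul_sum (w' : Cell a → ℝ) (F : Action a → Cell a → ℝ) :
    ∑ x, mixture γ lev w x * ∑ i, w' i * F x i =
      ∑ i, w' i * ∑ x, mixture γ lev w x * F x i := by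
  simp_rw [Finset.mul_sum]
  rw [Finset.sum_comm]
  exact Finset.sum_congr rfl fun i _ => Finset.sum_congr rfl fun x _ => by ring

/-- The estimated regret increment of one round against the expert `i'`, compensated by the terms
of the second order bound for exponential weights. -/
def roundTerm (γ η s b : ℝ) (lev : Block a → ℕ) (w : Cell a → ℝ) (i' : Cell a) (x : Action a)
    (v : ℝ) : ℝ :=
  -gft s b ((actionPrices lev x).1 / ((2 ^ a * 2 ^ a : ℕ) : ℝ))
      ((actionPrices lev x).2 / ((2 ^ a * 2 ^ a : ℕ) : ℝ)) -
    gainEst γ lev x v i' + ∑ i, w i * gainEst γ lev x v i + η * ∑ i, w i * gainEst γ lev x v i ^ 2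

/-- For the bit produced by the valuations `s`, `b`, the mean of `roundTerm` is at most `5 * γ`
minus the gain of the expert `i'`. For the rate `η` the second moment of `η * roundTerm` is at most
`11 * η * γ`, whence the bound on the exponential moment. -/
theorem sum_mixture_exp_roundTerm_le (hγ : 0 < γ) (hγ2 : γ ≤ 1 / 2)
    (hη : η = γ ^ 2 / (60 * 2 ^ a)) (hcard : (leaves lev).card ≤ 6 * 2 ^ a)
    (hw : ∀ i, 0 ≤ w i) (hw1 : ∑ i, w i = 1) {s b : ℝ} (hs : s ∈ Set.Icc (0 : ℝ) 1)
    (hb : b ∈ Set.Icc (0 : ℝ) 1) (i' : Cell a) :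
    ∑ x, mixture γ lev w x * Real.exp (η * roundTerm γ η s b lev w i' x
        (bitVal ⌈s * (2 ^ a * 2 ^ a : ℕ)⌉₊ ⌊b * (2 ^ a * 2 ^ a : ℕ)⌋₊ (actionPrices lev x)) -
      η * (16 * γ - gridGain (2 ^ a * 2 ^ a) ⌈s * (2 ^ a * 2 ^ a : ℕ)⌉₊
        ⌊b * (2 ^ a * 2 ^ a : ℕ)⌋₊ (leafPrices lev i'))) ≤ 1 := by
  have hQ : 0 < 2 ^ a * 2 ^ a := by positivity
  have hσ := ceil_mul_le (Q := 2 ^ a * 2 ^ a) hs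
  have hτ := floor_mul_le (Q := 2 ^ a * 2 ^ a) hb
  have hgg := gridGain_le_gft hQ hb (s := s)
  set σ := ⌈s * (2 ^ a * 2 ^ a : ℕ)⌉₊
  set τ := ⌊b * (2 ^ a * 2 ^ a : ℕ)⌋₊
  set V : Action a → ℝ := fun x => bitVal σ τ (actionPrices lev x) with hV
  have hV0 : ∀ x, 0 ≤ V x := fun x => bitVal_nonneg _ _ _
  have hV1 : ∀ x, V x ≤ 1 := fun x => bitVal_le_one _ _ _
  set E : Action a → Cell a → ℝ := fun x i => gainEst γ lev x (V x) i with hE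
  set g : Action a → ℝ := fun x => gft s b ((actionPrices lev x).1 / ((2 ^ a * 2 ^ a : ℕ) : ℝ))
      ((actionPrices lev x).2 / ((2 ^ a * 2 ^ a : ℕ) : ℝ)) with hg
  set d : Cell a → ℝ := fun i => gridGain (2 ^ a * 2 ^ a) σ τ (leafPrices lev i) with hd
  set K : ℝ := 2 ^ a with hK
  have hK1 : 1 ≤ K := one_le_pow₀ (by norm_num)
  set B := 18 * K / γ with hB
  have hBpos : 0 < B := by positivity
  have hηpos : 0 < η := by rw [hη]; positivity
  have hηB : η * B = 3 / 10 * γ := by rw [hη, hB]; field_simp; norm_num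
  have hη1 : η ≤ γ / 60 := by
    rw [hη, div_le_div_iff₀ (by positivity) (by norm_num)]
    nlinarith [mul_pos hγ hγ]
  have hEB : ∀ x i, |E x i| ≤ B := fun x i => abs_gainEst_le hγ x (hV0 x) (hV1 x) i
  have hg1 : ∀ x, |g x| ≤ 1 := fun x => abs_gft_le_one hs hb _ _
  set S1 : Action a → ℝ := fun x => ∑ i, w i * E x i with hS1
  set S2 : Action a → ℝ := fun x => ∑ i, w i * E x i ^ 2 with hS2
  have hS1B : ∀ x, |S1 x| ≤ B := fun x => by
    calc |S1 x| ≤ ∑ i, |w i * E x i| := Finset.abs_sum_le_sum_abs _ _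
      _ ≤ ∑ i, w i * B := Finset.sum_le_sum fun i _ => by
          rw [abs_mul, abs_of_nonneg (hw i)]
          exact mul_le_mul_of_nonneg_left (hEB x i) (hw i)
      _ = B := by rw [← Finset.sum_mul, hw1, one_mul]
  have hS20 : ∀ x, 0 ≤ S2 x := fun x =>
    Finset.sum_nonneg fun i _ => mul_nonneg (hw i) (sq_nonneg _)
  have hS2B : ∀ x, S2 x ≤ B ^ 2 := fun x => by
    calc S2 x ≤ ∑ i, w i * B ^ 2 := Finset.sum_le_sum fun i _ => by
          refine mul_le_mul_of_nonneg_left ?_ (hw i)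
          rw [← sq_abs]
          exact pow_le_pow_left₀ (abs_nonneg _) (hEB x i) 2
      _ = B ^ 2 := by rw [← Finset.sum_mul, hw1, one_mul]
  have hS12 : ∀ x, S1 x ^ 2 ≤ S2 x := fun x => by
    have := (even_two.convexOn_pow (𝕜 := ℝ)).map_sum_le (t := Finset.univ) (w := w) (p := E x)
      (fun i _ => hw i) hw1 (fun i _ => Set.mem_univ _)
    simpa only [smul_eq_mul] using this
  have hηS2 : ∀ x, (η * S2 x) ^ 2 ≤ S2 x := fun x => by
    calc (η * S2 x) ^ 2 = η ^ 2 * S2 x * S2 x := by ring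
      _ ≤ η ^ 2 * B ^ 2 * S2 x := by
          gcongr
          · exact hS20 x
          · exact hS2B x
      _ = (η * B) ^ 2 * S2 x := by ring
      _ ≤ 1 * S2 x := by
          refine mul_le_mul_of_nonneg_right ?_ (hS20 x)
          rw [hηB]
          nlinarith
      _ = S2 x := one_mul _
  have hρ0 := mixture_nonneg hγ hγ2 hcard hw
  have hρ1 := sum_mixture (γ := γ) (lev := lev) hw1
  have hmean : ∀ i, ∑ x, mixture γ lev w x * E x i = d i :=
    fun i => sum_mixture_gainEst hγ hσ hτ i
  have hsq : ∀ i, ∑ x, mixture γ lev w x * E x i ^ 2 ≤ 54 * K / γ :=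
    fun i => sum_mixture_gainEst_sq_le hγ hV0 hV1 i
  have hS2mean : ∑ x, mixture γ lev w x * S2 x ≤ 54 * K / γ := by
    rw [sum_mixture_mul_sum]
    calc _ ≤ ∑ i, w i * (54 * K / γ) :=
          Finset.sum_le_sum fun i _ => mul_le_mul_of_nonneg_left (hsq i) (hw i)
      _ = _ := by rw [← Finset.sum_mul, hw1, one_mul]
  have hS1mean : ∑ x, mixture γ lev w x * S1 x = ∑ i, w i * d i := by
    rw [sum_mixture_mul_sum]
    exact Finset.sum_congr rfl fun i _ => by rw [hmean]
  have hgmean : ∑ x, mixture γ lev w x * -g x ≤ -∑ i, w i * d i + 4 * γ := by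
    have h := sum_mixture_mul_le (lev := lev) (w := w) hγ (F := fun x => -g x)
      fun x => by linarith [(abs_le.1 (hg1 x)).1]
    have hc := probe_leaves_prob_le hγ hcard
    have hc0 : 0 ≤ γ * ((leaves lev).card / (6 * 2 ^ a) : ℝ) := by positivity
    set c := γ * ((leaves lev).card / (6 * 2 ^ a) : ℝ)
    have hdg : ∀ i, d i ≤ g (.inl i) := fun i => hgg _
    have h1 : ∑ i, w i * -g (.inl i) ≤ -∑ i, w i * d i := by
      rw [← Finset.sum_neg_distrib]
      exact Finset.sum_le_sum fun i _ => by
        have := mul_le_mul_of_nonneg_left (hdg i) (hw i)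
        linarith
    have h2 : ∑ i, w i * d i ≤ 1 := by
      calc _ ≤ ∑ i, w i * 1 := Finset.sum_le_sum fun i _ =>
            mul_le_mul_of_nonneg_left ((hdg i).trans (abs_le.1 (hg1 _)).2) (hw i)
        _ = 1 := by simp [hw1]
    have h3 := mul_le_mul_of_nonneg_left h1 (show 0 ≤ 1 - γ - c by linarith)
    have h4 := mul_le_mul_of_nonneg_left h2 (show 0 ≤ γ + c by linarith)
    linarith
  have hη54 : η * (54 * K / γ) = 9 / 10 * γ := by rw [hη]; field_simp; norm_num
  have hKγ : 1 ≤ K / γ := by rw [le_div_iff₀ hγ]; linarith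
  have key := sum_mul_exp_le (ρ := mixture γ lev w)
    (X := fun x => η * (-g x - E x i' + S1 x + η * S2 x)) (m := η * (5 * γ - d i'))
    (v := η * (11 * γ)) hρ0 hρ1 ?_ ?_ ?_
  · have e : η * (5 * γ - d i') + η * (11 * γ) = η * (16 * γ - d i') := by ring
    rw [e] at key
    exact key
  · intro x
    rw [abs_mul, abs_of_pos hηpos]
    have h1 : |-g x - E x i' + S1 x + η * S2 x| ≤ 1 + B + B + η * B ^ 2 := by
      have a1 := abs_le.1 (hg1 x)
      have a2 := abs_le.1 (hEB x i')
      have a3 := abs_le.1 (hS1B x)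
      have a4 := mul_le_mul_of_nonneg_left (hS2B x) hηpos.le
      have a5 := mul_nonneg hηpos.le (hS20 x)
      rw [abs_le]
      constructor <;> linarith
    calc _ ≤ η * (1 + B + B + η * B ^ 2) := mul_le_mul_of_nonneg_left h1 hηpos.le
      _ = η + 2 * (η * B) + (η * B) ^ 2 := by ring
      _ ≤ 1 := by rw [hηB]; nlinarith
  · have e : ∑ x, mixture γ lev w x * (η * (-g x - E x i' + S1 x + η * S2 x)) =
        η * (∑ x, mixture γ lev w x * -g x - ∑ x, mixture γ lev w x * E x i' +
          ∑ x, mixture γ lev w x * S1 x + η * ∑ x, mixture γ lev w x * S2 x) := by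
      simp only [Finset.mul_sum, ← Finset.sum_add_distrib, ← Finset.sum_sub_distrib]
      exact Finset.sum_congr rfl fun x _ => by ring
    rw [e, hmean, hS1mean]
    refine mul_le_mul_of_nonneg_left ?_ hηpos.le
    have := mul_le_mul_of_nonneg_left hS2mean hηpos.le
    rw [hη54] at this
    linarith
  · have hX : ∀ x, (η * (-g x - E x i' + S1 x + η * S2 x)) ^ 2 ≤
        4 * η ^ 2 * (1 + E x i' ^ 2 + 2 * S2 x) := fun x => by
      have h1 : g x ^ 2 ≤ 1 := by
        rw [← sq_abs]
        exact pow_le_one₀ (abs_nonneg _) (hg1 x)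
      have h2 := hS12 x
      have h3 := hηS2 x
      have h4 : (-g x - E x i' + S1 x + η * S2 x) ^ 2 ≤
          4 * (g x ^ 2 + E x i' ^ 2 + S1 x ^ 2 + (η * S2 x) ^ 2) := by
        generalize g x = y1; generalize E x i' = y2; generalize S1 x = y3
        generalize η * S2 x = y4
        nlinarith [sq_nonneg (y1 - y2), sq_nonneg (y1 + y3), sq_nonneg (y1 + y4),
          sq_nonneg (y2 + y3), sq_nonneg (y2 + y4), sq_nonneg (y3 - y4)]
      rw [mul_pow]
      have h5 : (-g x - E x i' + S1 x + η * S2 x) ^ 2 ≤ 4 * (1 + E x i' ^ 2 + 2 * S2 x) := by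
        linarith
      have := mul_le_mul_of_nonneg_left h5 (sq_nonneg η)
      linarith
    calc _ ≤ ∑ x, mixture γ lev w x * (4 * η ^ 2 * (1 + E x i' ^ 2 + 2 * S2 x)) :=
          Finset.sum_le_sum fun x _ => mul_le_mul_of_nonneg_left (hX x) (hρ0 x)
      _ = 4 * η ^ 2 * (∑ x, mixture γ lev w x + ∑ x, mixture γ lev w x * E x i' ^ 2 +
          2 * ∑ x, mixture γ lev w x * S2 x) := by
          simp only [Finset.mul_sum, ← Finset.sum_add_distrib]
          exact Finset.sum_congr rfl fun x _ => by ring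
      _ ≤ 4 * η ^ 2 * (163 * (K / γ)) := by
          refine mul_le_mul_of_nonneg_left ?_ (by positivity)
          have := hsq i'
          rw [mul_div_assoc] at this hS2mean
          linarith
      _ = η * (652 / 54 * (η * (54 * K / γ))) := by ring
      _ ≤ η * (11 * γ) := by
          rw [hη54]
          refine mul_le_mul_of_nonneg_left ?_ hηpos.le
          linarith

/-- The same for the estimates of the block indicators, with either sign `ε`. -/
theorem sum_mixture_exp_countEst_le (hγ : 0 < γ) (hγ2 : γ ≤ 1 / 2)
    (hη : η = γ ^ 2 / (60 * 2 ^ a)) (hcard : (leaves lev).card ≤ 6 * 2 ^ a)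
    (hw : ∀ i, 0 ≤ w i) (hw1 : ∑ i, w i = 1) (σ τ : ℕ) (j : Block a) {ε : ℝ}
    (hε : ε ^ 2 = 1) :
    ∑ x, mixture γ lev w x * Real.exp (η * (ε *
      (countEst γ x (bitVal σ τ (actionPrices lev x)) j - inBlock σ τ j)) - η * γ) ≤ 1 := by
  set K : ℝ := 2 ^ a with hK
  have hK1 : 1 ≤ K := one_le_pow₀ (by norm_num)
  have hηpos : 0 < η := by rw [hη]; positivity
  have hV0 : ∀ x, 0 ≤ bitVal σ τ (actionPrices lev x) := fun x => bitVal_nonneg _ _ _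
  have hV1 : ∀ x, bitVal σ τ (actionPrices lev x) ≤ 1 := fun x => bitVal_le_one _ _ _
  have hsq := sum_mixture_countEst_sq_le (lev := lev) (w := w) hγ hV0 hV1 j
  have hmean := sum_mixture_countEst (lev := lev) (w := w) hγ σ τ j
  have key := sum_mul_exp_le (ρ := mixture γ lev w)
    (X := fun x => η * ε * countEst γ x (bitVal σ τ (actionPrices lev x)) j)
    (m := η * ε * inBlock σ τ j) (v := η * γ)
    (mixture_nonneg hγ hγ2 hcard hw) (sum_mixture hw1) ?_ ?_ ?_
  · convert key using 4
    ring
  · intro x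
    have hε' : |ε| = 1 := by
      rw [← sq_abs] at hε
      nlinarith [abs_nonneg ε]
    rw [abs_mul, abs_mul, abs_of_pos hηpos, hε', mul_one]
    calc _ ≤ η * (4 * K / γ) :=
          mul_le_mul_of_nonneg_left (abs_countEst_le hγ x (hV0 x) (hV1 x) j) hηpos.le
      _ = 1 / 15 * γ := by rw [hη]; field_simp; norm_num
      _ ≤ 1 := by linarith
  · rw [← hmean, Finset.mul_sum]
    exact (Finset.sum_congr rfl fun x _ => by ring).le
  · calc _ = η ^ 2 * ∑ x, mixture γ lev w x *
          countEst γ x (bitVal σ τ (actionPrices lev x)) j ^ 2 := by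
          rw [Finset.mul_sum]
          refine Finset.sum_congr rfl fun x _ => ?_
          rw [mul_pow, mul_pow, hε]
          ring
      _ ≤ η ^ 2 * (16 * K / γ) := mul_le_mul_of_nonneg_left hsq (sq_nonneg _)
      _ = η * (4 / 15 * γ) := by rw [hη]; field_simp; norm_num
      _ ≤ η * γ := mul_le_mul_of_nonneg_left (by linarith) hηpos.le

end RoundTerm

/-! ### The policy and its deterministic analysis -/

/-- A feedback bit as a real number. -/
def bitReal (c : Bool) : ℝ := if c then 1 else 0

/-- The cumulative estimate, along a record, of the number of rounds with both valuations in the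
block `j`. -/
def cumCount (γ : ℝ) : List (Action a × Bool) → Block a → ℝ
  | [], _ => 0
  | (x, c) :: r, j => countEst γ x (bitReal c) j + cumCount γ r j

/-- The refinement level of a block with estimated count `y`: about `y / θ` leaves, but no leaf
smaller than a cell. -/
def rawLevel (a : ℕ) (θ y : ℝ) : ℕ := min a (Nat.clog 2 ⌈y / θ⌉₊)

/-- The levels used after the record `r`. The partition falls back to the unrefined blocks if the
estimates would call for more than `6 * 2 ^ a` leaves. -/
def levels (γ θ : ℝ) (r : List (Action a × Bool)) : Block a → ℕ :=
  if (leaves fun j => rawLevel a θ (cumCount γ r j)).card ≤ 6 * 2 ^ a then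
    fun j => rawLevel a θ (cumCount γ r j)
  else fun _ => 0

/-- The cumulative estimated gain of the expert `i` along a record. -/
def cumGain (γ θ : ℝ) : List (Action a × Bool) → Cell a → ℝ
  | [], _ => 0
  | (x, c) :: r, i => gainEst γ (levels γ θ r) x (bitReal c) i + cumGain γ θ r i

/-- The weights of the experts after the record `r`. -/
def weights (γ η θ : ℝ) (r : List (Action a × Bool)) : Cell a → ℝ := expWeight η (cumGain γ θ r)

theorem card_leaves_levels_le (γ θ : ℝ) (r : List (Action a × Bool)) :
    (leaves (levels γ θ r)).card ≤ 6 * 2 ^ a := by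
  unfold levels
  split_ifs with h
  · exact h
  · have := card_leaves_le (fun _ : Block a => 0) fun _ => Nat.zero_le _
    simp at this
    omega

instance : Nonempty (Cell a) := ⟨⟨0, by positivity⟩⟩

section RawLevel

variable {θ y M : ℝ}

/-- The number of leaves of a block is at most of the order of its count. -/
theorem two_pow_rawLevel_le (hθ : 0 < θ) (hM : 0 ≤ M) (h : y ≤ M + θ) :
    (2 : ℝ) ^ rawLevel a θ y ≤ 4 + 2 * M / θ := by
  have hMθ : 0 ≤ M / θ := div_nonneg hM hθ.le
  have h1 : ⌈y / θ⌉₊ ≤ ⌈(M + θ) / θ⌉₊ := Nat.ceil_mono (by gcongr)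
  have h2 : (⌈(M + θ) / θ⌉₊ : ℝ) < M / θ + 2 := by
    have := Nat.ceil_lt_add_one (a := (M + θ) / θ) (by positivity)
    rw [add_div, div_self hθ.ne'] at this
    rw [add_div, div_self hθ.ne']
    linarith
  set n := ⌈y / θ⌉₊
  have h3 : (n : ℝ) ≤ M / θ + 2 := by
    have : (n : ℝ) ≤ ⌈(M + θ) / θ⌉₊ := by exact_mod_cast h1
    linarith
  have h4 : 2 ^ Nat.clog 2 n ≤ max 1 (2 * n) := by
    rcases Nat.lt_or_ge 1 n with hn | hn
    · have h5 := Nat.pow_pred_clog_lt_self Nat.one_lt_two hn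
      have h6 := Nat.clog_pos Nat.one_lt_two hn
      obtain ⟨k, hk⟩ := Nat.exists_eq_succ_of_ne_zero h6.ne'
      rw [hk] at h5 ⊢
      rw [Nat.pred_succ] at h5
      rw [Nat.succ_eq_add_one, pow_succ]
      omega
    · rw [Nat.clog_of_right_le_one hn]
      simp
  calc (2 : ℝ) ^ rawLevel a θ y ≤ 2 ^ Nat.clog 2 n :=
        pow_le_pow_right₀ (by norm_num) (min_le_right _ _)
    _ ≤ max 1 (2 * (n : ℝ)) := by exact_mod_cast h4
    _ ≤ 4 + 2 * M / θ := by
        rw [mul_div_assoc]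
        exact max_le (by linarith) (by linarith)

/-- Either the block is fully refined, or its number of leaves is of the order of its count. -/
theorem inv_two_pow_rawLevel_le (hθ : 1 ≤ θ) (hM : 0 ≤ M) (h : M - θ ≤ y) :
    ((2 : ℝ) ^ rawLevel a θ y)⁻¹ ≤ (2 ^ a)⁻¹ + 3 * θ / (M + 1) := by
  have hθ0 : 0 < θ := by linarith
  have h3 : 0 ≤ 3 * θ / (M + 1) := by positivity
  have h4 : (0 : ℝ) ≤ (2 ^ a)⁻¹ := by positivity
  unfold rawLevel
  rcases le_total a (Nat.clog 2 ⌈y / θ⌉₊) with hl | hl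
  · rw [min_eq_left hl]
    linarith
  · rw [min_eq_right hl]
    set n := ⌈y / θ⌉₊
    have h5 : (n : ℝ) ≤ 2 ^ Nat.clog 2 n := by
      exact_mod_cast Nat.le_pow_clog Nat.one_lt_two n
    have h6 : y / θ ≤ n := Nat.le_ceil _
    have h7 : (1 : ℝ) ≤ 2 ^ Nat.clog 2 n := one_le_pow₀ (by norm_num)
    have h8 : y ≤ 2 ^ Nat.clog 2 n * θ := (div_le_iff₀ hθ0).1 (h6.trans h5)
    set N : ℝ := 2 ^ Nat.clog 2 n
    have h9 : N⁻¹ ≤ 3 * θ / (M + 1) := by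
      rw [inv_le_iff_one_le_mul₀ (by linarith), div_mul_eq_mul_div, le_div_iff₀ (by linarith)]
      nlinarith
    linarith

end RawLevel

/-- When the estimated counts are accurate up to `θ`, the cap on the number of leaves is not
active. -/
theorem levels_eq_rawLevel {γ θ S : ℝ} {r : List (Action a × Bool)} {M : Block a → ℝ}
    (hθ : 0 < θ) (hM : ∀ j, 0 ≤ M j) (hsum : ∑ j, M j ≤ S) (hS : S ≤ θ * 2 ^ a)
    (h : ∀ j, cumCount γ r j ≤ M j + θ) :
    levels γ θ r = fun j => rawLevel a θ (cumCount γ r j) := by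
  refine if_pos ?_
  have h1 := card_leaves_le (fun j => rawLevel a θ (cumCount γ r j)) fun _ => min_le_left _ _
  have h2 : ((∑ j : Block a, 2 ^ rawLevel a θ (cumCount γ r j) : ℕ) : ℝ) ≤ 6 * 2 ^ a := by
    push_cast
    calc _ ≤ ∑ j : Block a, (4 + 2 * M j / θ) :=
          Finset.sum_le_sum fun j _ => two_pow_rawLevel_le hθ (hM j) (h j)
      _ = 4 * 2 ^ a + 2 * (∑ j, M j) / θ := by
          rw [Finset.sum_add_distrib, ← Finset.sum_div, ← Finset.mul_sum]
          simp [mul_comm]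
      _ ≤ 4 * 2 ^ a + 2 * (θ * 2 ^ a) / θ := by
          have : ∑ j, M j ≤ θ * 2 ^ a := hsum.trans hS
          gcongr
      _ = 6 * 2 ^ a := by field_simp; norm_num
  exact h1.trans (by exact_mod_cast h2)

theorem inBlock_nonneg (σ τ : ℕ) (j : Block a) : 0 ≤ inBlock σ τ j := by
  unfold inBlock; split_ifs <;> norm_num

theorem inBlock_le_one (σ τ : ℕ) (j : Block a) : inBlock σ τ j ≤ 1 := by
  unfold inBlock; split_ifs <;> norm_num

theorem sum_inBlock_le_one (σ τ : ℕ) : ∑ j : Block a, inBlock σ τ j ≤ 1 := by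
  by_cases h : ∃ j : Block a, inBlock σ τ j ≠ 0
  · obtain ⟨j, hj⟩ := h
    rw [Finset.sum_eq_single j _ (by simp)]
    · exact inBlock_le_one σ τ j
    · intro j' _ hjj
      by_contra hj'
      have k1 : (j : ℕ) * 2 ^ a ≤ τ ∧ τ < (j + 1) * 2 ^ a := by
        by_contra hc
        exact hj (if_neg fun h => hc h.1)
      have k2 : (j' : ℕ) * 2 ^ a ≤ τ ∧ τ < (j' + 1) * 2 ^ a := by
        by_contra hc
        exact hj' (if_neg fun h => hc h.1)
      have e1 := Nat.div_eq_of_lt_le k1.1 k1.2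
      have e2 := Nat.div_eq_of_lt_le k2.1 k2.2
      exact hjj (Fin.ext (e2.symm.trans e1))
  · push Not at h
    simp [h]

/-- The sum of `m t / (1 + M t)` over increments `m t` with partial sums `M t` is logarithmic. -/
theorem sum_div_partial_sum_le (m : ℕ → ℝ) (h0 : ∀ t, 0 ≤ m t) (h1 : ∀ t, m t ≤ 1) (n : ℕ) :
    ∑ t ∈ Finset.range n, m t / (∑ u ∈ Finset.range t, m u + 1) ≤
      2 * Real.log (∑ u ∈ Finset.range n, m u + 1) := by
  induction n with
  | zero => simp
  | succ n ih =>
    rw [Finset.sum_range_succ, Finset.sum_range_succ (f := m)]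
    have hM : 0 ≤ ∑ u ∈ Finset.range n, m u := Finset.sum_nonneg fun _ _ => h0 _
    generalize (∑ u ∈ Finset.range n, m u) = M at *
    have hm0 := h0 n
    have hm1 := h1 n
    generalize m n = y at *
    have hpos : 0 < M + y + 1 := by linarith
    have hpos1 : 0 < M + 1 := by linarith
    have hl : Real.log (M + y + 1) = Real.log (M + 1) + Real.log ((M + y + 1) / (M + 1)) := by
      rw [Real.log_div hpos.ne' hpos1.ne']; ring
    have h2 := Real.one_sub_inv_le_log_of_pos (div_pos hpos hpos1)
    have h3 : y / (M + 1) ≤ 2 * (1 - ((M + y + 1) / (M + 1))⁻¹) := by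
      rw [inv_div, one_sub_div hpos.ne', mul_div_assoc', div_le_div_iff₀ hpos1 hpos]
      nlinarith
    linarith

/-- The second order regret bound of exponential weights along a trajectory. -/
theorem neg_log_card_le_sum {γ η θ : ℝ} (hγ : 0 < γ) (hη : 0 ≤ η)
    (hηB : η * (18 * 2 ^ a / γ) ≤ 1) {r : ℕ → List (Action a × Bool)} {x : ℕ → Action a}
    {c : ℕ → Bool} (h0 : r 0 = []) (hr : ∀ t, r (t + 1) = (x t, c t) :: r t) (i' : Cell a)
    (n : ℕ) :
    -Real.log ((2 ^ a * 2 ^ a : ℕ) : ℝ) ≤ η * ∑ t ∈ Finset.range n,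
      (-gainEst γ (levels γ θ (r t)) (x t) (bitReal (c t)) i' +
        ∑ i, weights γ η θ (r t) i * gainEst γ (levels γ θ (r t)) (x t) (bitReal (c t)) i +
        η * ∑ i, weights γ η θ (r t) i *
          gainEst γ (levels γ θ (r t)) (x t) (bitReal (c t)) i ^ 2) := by
  have hc : ∀ t, 0 ≤ bitReal (c t) ∧ bitReal (c t) ≤ 1 := fun t => by
    unfold bitReal; split_ifs <;> norm_num
  have hgain : ∀ t i, cumGain γ θ (r (t + 1)) i =
      gainEst γ (levels γ θ (r t)) (x t) (bitReal (c t)) i + cumGain γ θ (r t) i := fun t i => by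
    rw [hr]; rfl
  have key : ∀ n, η * cumGain γ θ (r n) i' -
      Real.log ((2 ^ a * 2 ^ a : ℕ) : ℝ) ≤
      η * cumGain γ θ (r n) i' - Real.log (∑ i, Real.exp (η * cumGain γ θ (r n) i)) +
        η * ∑ t ∈ Finset.range n,
        (∑ i, weights γ η θ (r t) i * gainEst γ (levels γ θ (r t)) (x t) (bitReal (c t)) i +
        η * ∑ i, weights γ η θ (r t) i *
          gainEst γ (levels γ θ (r t)) (x t) (bitReal (c t)) i ^ 2) := by
    intro n
    induction n with
    | zero => simp [h0, cumGain]
    | succ n ih =>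
      rw [Finset.sum_range_succ, mul_add]
      have h := log_sum_exp_add_le (η := η) (cumGain γ θ (r n))
        (fun i => gainEst γ (levels γ θ (r n)) (x n) (bitReal (c n)) i) fun i => by
          rw [abs_mul, abs_of_nonneg hη]
          exact (mul_le_mul_of_nonneg_left
            (abs_gainEst_le hγ _ (hc n).1 (hc n).2 i) hη).trans hηB
      simp_rw [← hgain] at h
      simp only [weights] at ih ⊢
      linarith
  have hsum : ∀ n, cumGain γ θ (r n) i' = ∑ t ∈ Finset.range n,
      gainEst γ (levels γ θ (r t)) (x t) (bitReal (c t)) i' := by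
    intro n
    induction n with
    | zero => simp [h0, cumGain]
    | succ n ih => rw [Finset.sum_range_succ, hgain, ih, add_comm]
  have h1 := key n
  have h2 := le_log_sum_exp η (cumGain γ θ (r n)) i'
  rw [hsum] at h1 h2
  simp only [Finset.sum_add_distrib, Finset.sum_neg_distrib] at h1 ⊢
  linarith

theorem cumCount_eq_sum {γ : ℝ} {r : ℕ → List (Action a × Bool)} {x : ℕ → Action a}
    {c : ℕ → Bool} (h0 : r 0 = []) (hr : ∀ t, r (t + 1) = (x t, c t) :: r t) (j : Block a)
    (n : ℕ) :
    cumCount γ (r n) j = ∑ t ∈ Finset.range n, countEst γ (x t) (bitReal (c t)) j := by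
  induction n with
  | zero => simp [h0, cumCount]
  | succ n ih => rw [Finset.sum_range_succ, hr, cumCount, ih, add_comm]

/-- The cell of the finest partition that contains the price `p`. -/
theorem exists_cell {p : ℝ} (hp : p ∈ Set.Icc (0 : ℝ) 1) (a : ℕ) :
    ∃ i : Cell a, (i : ℝ) ≤ p * (2 ^ a * 2 ^ a : ℕ) ∧ p * (2 ^ a * 2 ^ a : ℕ) ≤ (i : ℝ) + 1 := by
  have hQ : 0 < 2 ^ a * 2 ^ a := by positivity
  set Q := 2 ^ a * 2 ^ a
  have hpQ : p * Q ≤ Q := mul_le_of_le_one_left (Nat.cast_nonneg _) hp.2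
  have hpQ0 : 0 ≤ p * Q := mul_nonneg hp.1 (Nat.cast_nonneg _)
  rcases lt_or_ge ⌊p * Q⌋₊ Q with h | h
  · exact ⟨⟨⌊p * Q⌋₊, h⟩, Nat.floor_le hpQ0, (Nat.lt_floor_add_one _).le⟩
  · have h1 : (Q : ℝ) ≤ p * Q := (Nat.le_floor_iff hpQ0).1 h
    refine ⟨⟨Q - 1, by omega⟩, ?_, ?_⟩ <;> simp only <;> rw [Nat.cast_sub hQ, Nat.cast_one] <;>
      linarith

/-- Against a fixed price `p`, the expert whose cell contains `p` loses only the rounding error and,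
in the rounds with both valuations in its block, the relative width of its leaf. -/
theorem gft_le_gridGain_leafPrices {s b p : ℝ} (hs : s ∈ Set.Icc (0 : ℝ) 1)
    {lev : Block a → ℕ} {i : Cell a} (hlev : lev (block i) ≤ a)
    (h1 : (i : ℝ) ≤ p * (2 ^ a * 2 ^ a : ℕ)) (h2 : p * (2 ^ a * 2 ^ a : ℕ) ≤ (i : ℝ) + 1) :
    gft s b p p ≤ gridGain (2 ^ a * 2 ^ a) ⌈s * (2 ^ a * 2 ^ a : ℕ)⌉₊
        ⌊b * (2 ^ a * 2 ^ a : ℕ)⌋₊ (leafPrices lev i) + 2 / (2 ^ a * 2 ^ a) +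
      inBlock ⌈s * (2 ^ a * 2 ^ a : ℕ)⌉₊ ⌊b * (2 ^ a * 2 ^ a : ℕ)⌋₊ (block i) *
        ((2 ^ a)⁻¹ * (2 ^ lev (block i))⁻¹) := by
  have hQ : 0 < 2 ^ a * 2 ^ a := by positivity
  have k1 := leaf_le lev i
  have k2 := lt_leaf_add_width lev i
  have k3 := block_mul_le_leaf lev i
  have k4 := leaf_add_width_le lev i
  have h3 : ((leaf lev i : ℕ) : ℝ) ≤ p * (2 ^ a * 2 ^ a : ℕ) :=
    le_trans (by exact_mod_cast k1) h1
  have h4 : p * (2 ^ a * 2 ^ a : ℕ) ≤ ((leaf lev i + width lev i : ℕ) : ℝ) :=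
    h2.trans (by exact_mod_cast k2)
  have h := gft_le_gridGain_add hQ (b := b) hs h3 h4
  set σ := ⌈s * (2 ^ a * 2 ^ a : ℕ)⌉₊
  set τ := ⌊b * (2 ^ a * 2 ^ a : ℕ)⌋₊
  have hw : (((leaf lev i + width lev i : ℕ) : ℝ) - (leaf lev i : ℕ)) / (2 ^ a * 2 ^ a : ℕ) =
      (2 ^ a)⁻¹ * (2 ^ lev (block i))⁻¹ := by
    have : (2 : ℝ) ^ a = 2 ^ lev (block i) * 2 ^ (a - lev (block i)) := by
      rw [← pow_add, Nat.add_sub_cancel' hlev]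
    push_cast [width]
    rw [add_sub_cancel_left, div_eq_iff (by positivity)]
    rw [this]
    field_simp
  have hnn : (0 : ℝ) ≤ (2 ^ a)⁻¹ * (2 ^ lev (block i))⁻¹ := by positivity
  have hite : (if (leaf lev i : ℕ) ≤ τ ∧ τ < leaf lev i + width lev i ∧ (leaf lev i : ℕ) < σ ∧
      σ ≤ leaf lev i + width lev i then (((leaf lev i + width lev i : ℕ) : ℝ) -
        (leaf lev i : ℕ)) / (2 ^ a * 2 ^ a : ℕ) else 0) ≤
      inBlock σ τ (block i) * ((2 ^ a)⁻¹ * (2 ^ lev (block i))⁻¹) := by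
    rw [hw]
    split_ifs with hc
    · rw [inBlock, if_pos ⟨⟨by omega, by omega⟩, by omega, by omega⟩, one_mul]
    · exact mul_nonneg (inBlock_nonneg _ _ _) hnn
  have e : (2 : ℝ) / ((2 ^ a * 2 ^ a : ℕ) : ℝ) = 2 / (2 ^ a * 2 ^ a) := by push_cast; rfl
  rw [e] at h
  unfold leafPrices
  linarith

theorem bitReal_trade {Q : ℕ} (hQ : 0 < Q) {s b : ℝ} (hb : 0 ≤ b) (x : ℕ × ℕ) :
    bitReal (trade s b (x.1 / Q) (x.2 / Q)) = bitVal ⌈s * Q⌉₊ ⌊b * Q⌋₊ x := by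
  rw [trade_grid hQ hb]
  simp [bitReal, bitVal]

/-- The regret against a fixed price along a trajectory on which the compensated sum of the round
terms is small and the counts of the blocks are accurate up to `θ`. -/
theorem sum_gft_sub_le {γ η θ x₀ p : ℝ} {s b : ℕ → ℝ} {T : ℕ} (hγ : 0 < γ) (hγ2 : γ ≤ 1 / 2)
    (hη : η = γ ^ 2 / (60 * 2 ^ a)) (hθ : 1 ≤ θ) (hθT : T ≤ θ * 2 ^ a)
    (hsb : ∀ t < T, s t ∈ Set.Icc (0 : ℝ) 1 ∧ b t ∈ Set.Icc (0 : ℝ) 1)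
    {r : ℕ → List (Action a × Bool)} {x : ℕ → Action a} {c : ℕ → Bool} (h0 : r 0 = [])
    (hr : ∀ t, r (t + 1) = (x t, c t) :: r t) {i' : Cell a}
    (hi1 : (i' : ℝ) ≤ p * (2 ^ a * 2 ^ a : ℕ)) (hi2 : p * (2 ^ a * 2 ^ a : ℕ) ≤ (i' : ℝ) + 1)
    (hmart : ∑ t ∈ Finset.range T,
      (η * roundTerm γ η (s t) (b t) (levels γ θ (r t)) (weights γ η θ (r t)) i' (x t)
        (bitReal (c t)) - η * (16 * γ - gridGain (2 ^ a * 2 ^ a)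
          ⌈s t * (2 ^ a * 2 ^ a : ℕ)⌉₊ ⌊b t * (2 ^ a * 2 ^ a : ℕ)⌋₊
          (leafPrices (levels γ θ (r t)) i'))) ≤ x₀)
    (hcount : ∀ t < T, ∀ j : Block a, |cumCount γ (r t) j - ∑ u ∈ Finset.range t,
      inBlock ⌈s u * (2 ^ a * 2 ^ a : ℕ)⌉₊ ⌊b u * (2 ^ a * 2 ^ a : ℕ)⌋₊ j| ≤ θ) :
    ∑ t ∈ Finset.range T, gft (s t) (b t) p p - ∑ t ∈ Finset.range T, gft (s t) (b t)
      ((actionPrices (levels γ θ (r t)) (x t)).1 / ((2 ^ a * 2 ^ a : ℕ) : ℝ))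
      ((actionPrices (levels γ θ (r t)) (x t)).2 / ((2 ^ a * 2 ^ a : ℕ) : ℝ)) ≤
      16 * γ * T + (x₀ + Real.log ((2 ^ a * 2 ^ a : ℕ) : ℝ)) / η + 3 * (T / (2 ^ a * 2 ^ a)) +
        6 * θ / 2 ^ a * Real.log (T + 1) := by
  have hηpos : 0 < η := by rw [hη]; positivity
  have hηB : η * (18 * 2 ^ a / γ) ≤ 1 := by
    have : η * (18 * 2 ^ a / γ) = 3 / 10 * γ := by rw [hη]; field_simp; norm_num
    linarith
  set σ : ℕ → ℕ := fun t => ⌈s t * (2 ^ a * 2 ^ a : ℕ)⌉₊ with hσ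
  set τ : ℕ → ℕ := fun t => ⌊b t * (2 ^ a * 2 ^ a : ℕ)⌋₊ with hτ
  set d : ℕ → ℝ := fun t => gridGain (2 ^ a * 2 ^ a) (σ t) (τ t)
    (leafPrices (levels γ θ (r t)) i') with hd
  set g : ℕ → ℝ := fun t => gft (s t) (b t)
      ((actionPrices (levels γ θ (r t)) (x t)).1 / ((2 ^ a * 2 ^ a : ℕ) : ℝ))
      ((actionPrices (levels γ θ (r t)) (x t)).2 / ((2 ^ a * 2 ^ a : ℕ) : ℝ)) with hg
  set m : ℕ → ℝ := fun t => inBlock (σ t) (τ t) (block i') with hm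
  have hm0 : ∀ t, 0 ≤ m t := fun t => inBlock_nonneg _ _ _
  have hm1 : ∀ t, m t ≤ 1 := fun t => inBlock_le_one _ _ _
  -- the part of the regret due to learning
  have hlearn : ∑ t ∈ Finset.range T, d t - ∑ t ∈ Finset.range T, g t ≤
      16 * γ * T + (x₀ + Real.log ((2 ^ a * 2 ^ a : ℕ) : ℝ)) / η := by
    have hedge := neg_log_card_le_sum (θ := θ) hγ hηpos.le hηB h0 hr i' T
    set H : ℕ → ℝ := fun t => -gainEst γ (levels γ θ (r t)) (x t) (bitReal (c t)) i' +
        ∑ i, weights γ η θ (r t) i * gainEst γ (levels γ θ (r t)) (x t) (bitReal (c t)) i +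
        η * ∑ i, weights γ η θ (r t) i *
          gainEst γ (levels γ θ (r t)) (x t) (bitReal (c t)) i ^ 2 with hH
    have e : ∑ t ∈ Finset.range T,
      (η * roundTerm γ η (s t) (b t) (levels γ θ (r t)) (weights γ η θ (r t)) i' (x t)
        (bitReal (c t)) - η * (16 * γ - d t)) =
        η * (∑ t ∈ Finset.range T, d t - ∑ t ∈ Finset.range T, g t - 16 * γ * T) +
          η * ∑ t ∈ Finset.range T, H t := by
      have : (16 * γ * T : ℝ) = ∑ t ∈ Finset.range T, 16 * γ := by simp; ring
      rw [this, ← Finset.sum_sub_distrib, ← Finset.sum_sub_distrib, Finset.mul_sum,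
        Finset.mul_sum, ← Finset.sum_add_distrib]
      refine Finset.sum_congr rfl fun t _ => ?_
      simp only [roundTerm, hH, hg]
      ring
    rw [e] at hmart
    rw [← sub_le_iff_le_add', le_div_iff₀ hηpos]
    linarith
  -- the part of the regret due to the discretization of the prices
  have hcell : ∀ t ∈ Finset.range T, gft (s t) (b t) p p ≤ d t + 3 / (2 ^ a * 2 ^ a) +
      3 * θ / 2 ^ a * (m t / (∑ u ∈ Finset.range t, m u + 1)) := by
    intro t ht
    rw [Finset.mem_range] at ht
    have hM0 : ∀ j : Block a, 0 ≤ ∑ u ∈ Finset.range t, inBlock (σ u) (τ u) j :=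
      fun j => Finset.sum_nonneg fun _ _ => inBlock_nonneg _ _ _
    have hlev : levels γ θ (r t) = fun j => rawLevel a θ (cumCount γ (r t) j) := by
      refine levels_eq_rawLevel (by linarith) hM0 ?_ hθT fun j => ?_
      · rw [Finset.sum_comm]
        calc _ ≤ ∑ u ∈ Finset.range t, (1 : ℝ) :=
              Finset.sum_le_sum fun u _ => sum_inBlock_le_one _ _
          _ ≤ T := by simpa using ht.le
      · have := (abs_le.1 (hcount t ht j)).2
        linarith
    have hle : levels γ θ (r t) (block i') ≤ a := by
      rw [hlev]; exact min_le_left _ _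
    have h1 := gft_le_gridGain_leafPrices (b := b t) (hsb t ht).1 hle hi1 hi2
    have h2 : ((2 : ℝ) ^ levels γ θ (r t) (block i'))⁻¹ ≤
        (2 ^ a)⁻¹ + 3 * θ / (∑ u ∈ Finset.range t, m u + 1) := by
      rw [hlev]
      refine inv_two_pow_rawLevel_le hθ (hM0 (block i')) ?_
      have := (abs_le.1 (hcount t ht (block i'))).1
      linarith
    have hK : (0 : ℝ) ≤ (2 ^ a)⁻¹ := by positivity
    have h3 : m t * ((2 ^ a)⁻¹ * (2 ^ levels γ θ (r t) (block i'))⁻¹) ≤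
        m t * ((2 ^ a)⁻¹ * ((2 ^ a)⁻¹ + 3 * θ / (∑ u ∈ Finset.range t, m u + 1))) :=
      mul_le_mul_of_nonneg_left (mul_le_mul_of_nonneg_left h2 hK) (hm0 t)
    have h4 : m t * ((2 ^ a)⁻¹ * (2 ^ a)⁻¹) ≤ 1 * ((2 ^ a)⁻¹ * (2 ^ a)⁻¹) :=
      mul_le_mul_of_nonneg_right (hm1 t) (by positivity)
    have e1 : (3 : ℝ) / (2 ^ a * 2 ^ a) = 2 / (2 ^ a * 2 ^ a) + 1 * ((2 ^ a)⁻¹ * (2 ^ a)⁻¹) := by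
      field_simp; norm_num
    have e2 : m t * ((2 ^ a)⁻¹ * ((2 ^ a)⁻¹ + 3 * θ / (∑ u ∈ Finset.range t, m u + 1))) =
        m t * ((2 ^ a)⁻¹ * (2 ^ a)⁻¹) +
          3 * θ / 2 ^ a * (m t / (∑ u ∈ Finset.range t, m u + 1)) := by
      ring
    rw [e2] at h3
    change gft (s t) (b t) p p ≤ d t + 2 / (2 ^ a * 2 ^ a) +
      m t * ((2 ^ a)⁻¹ * (2 ^ levels γ θ (r t) (block i'))⁻¹) at h1
    rw [e1]
    linarith
  have hsum := Finset.sum_le_sum hcell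
  rw [Finset.sum_add_distrib, Finset.sum_add_distrib, ← Finset.mul_sum] at hsum
  have hlog : ∑ t ∈ Finset.range T, m t / (∑ u ∈ Finset.range t, m u + 1) ≤
      2 * Real.log (T + 1) := by
    refine (sum_div_partial_sum_le m hm0 hm1 T).trans ?_
    have h5 : ∑ u ∈ Finset.range T, m u ≤ T := by
      calc _ ≤ ∑ u ∈ Finset.range T, (1 : ℝ) := Finset.sum_le_sum fun u _ => hm1 u
        _ = T := by simp
    have h6 : 0 ≤ ∑ u ∈ Finset.range T, m u := Finset.sum_nonneg fun u _ => hm0 u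
    have := Real.log_le_log (x := ∑ u ∈ Finset.range T, m u + 1) (y := T + 1) (by linarith)
      (by linarith)
    linarith
  have hlog' := mul_le_mul_of_nonneg_left hlog (show 0 ≤ 3 * θ / 2 ^ a by positivity)
  have e3 : ∑ t ∈ Finset.range T, (3 : ℝ) / (2 ^ a * 2 ^ a) = 3 * (T / (2 ^ a * 2 ^ a)) := by
    simp; ring
  have e4 : 3 * θ / 2 ^ a * (2 * Real.log (T + 1)) = 6 * θ / 2 ^ a * Real.log (T + 1) := by
    ring
  linarith

/-! ### The guarantees of the learner -/

/-- The guarantees in terms of the number `2 ^ a` of blocks. The relation between `γ`, `T` and `a`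
balances the cost `γ * T` of probing with the regret of exponential weights, which is of order
`1 / η = 480 * (γ * T)`; the condition `γ * 2 ^ a ≤ 1` says that the error of the counts, of the
order `γ * T`, does not exceed `T / 2 ^ a`. -/
theorem exists_learner_of_tuning {T : ℕ} {γ δ : ℝ} (hT : 1 ≤ T) (hγ : 0 < γ) (hγ2 : γ ≤ 1 / 2)
    (hγT : 8 * γ ^ 3 * T = 2 ^ a) (hγa : γ * 2 ^ a ≤ 1) (hδ : 0 < δ) (hδ1 : δ < 1) :
    ∃ A : Learner, ∀ s b : ℕ → ℝ,
      (∀ t < T, s t ∈ Set.Icc (0 : ℝ) 1 ∧ b t ∈ Set.Icc (0 : ℝ) 1) →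
      (∀ ω : A.Ω, A.violation s b T ω ≤ T / 2 ^ a) ∧
      1 - 3 * δ ≤ A.μ.real {ω : A.Ω | A.regret s b T ω ≤
        16 * (γ * T) + 480 * (γ * T) * (Real.log (1 / δ) + Real.log (2 ^ a * 2 ^ a)) +
          3 * (T / (2 ^ a * 2 ^ a)) + 2886 * (T / (2 ^ a * 2 ^ a)) *
            (1 + Real.log (2 ^ a * T / δ)) * Real.log (T + 1)} := by
  have hT' : (1 : ℝ) ≤ T := by exact_mod_cast hT
  have hK1 : (1 : ℝ) ≤ 2 ^ a := one_le_pow₀ (by norm_num)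
  set lg := Real.log (2 ^ a * T / δ) with hlg
  have hlg0 : 0 ≤ lg := by
    refine Real.log_nonneg ?_
    rw [le_div_iff₀ hδ]
    nlinarith
  obtain ⟨η, hη⟩ : ∃ η : ℝ, η = γ ^ 2 / (60 * 2 ^ a) := ⟨_, rfl⟩
  -- `θ` exceeds both the deviation `γ * T + lg / η` of the counts and `T / 2 ^ a`
  obtain ⟨θ, hθ⟩ : ∃ θ : ℝ, θ = 481 * (T / 2 ^ a) * (1 + lg) := ⟨_, rfl⟩
  have hηpos : 0 < η := by rw [hη]; positivity
  have hηinv : 1 / η = 480 * (γ * T) := by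
    rw [hη, ← hγT]
    field_simp
    norm_num
  have hKT : (2 : ℝ) ^ a ≤ T := by
    rw [← hγT]
    have : γ ^ 3 ≤ (1 / 2) ^ 3 := pow_le_pow_left₀ hγ.le hγ2 3
    nlinarith
  have hTK1 : 1 ≤ T / (2 : ℝ) ^ a := by rwa [one_le_div (by positivity)]
  have hγTK : γ * T ≤ T / 2 ^ a := by
    rw [le_div_iff₀ (by positivity)]
    nlinarith
  have hθ1 : T / (2 : ℝ) ^ a ≤ θ := by
    rw [hθ]
    nlinarith
  have hcard := fun r : List (Action a × Bool) => card_leaves_levels_le γ θ r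
  have hw0 := fun r : List (Action a × Bool) => expWeight_nonneg η (cumGain γ θ r)
  have hw1 := fun r : List (Action a × Bool) => sum_expWeight η (cumGain γ θ r)
  have hQ : 0 < 2 ^ a * 2 ^ a := by positivity
  have hQ' : (0 : ℝ) < ((2 ^ a * 2 ^ a : ℕ) : ℝ) := by exact_mod_cast hQ
  have hmem : ∀ k : ℕ, k ≤ 2 ^ a * 2 ^ a →
      (k : ℝ) / ((2 ^ a * 2 ^ a : ℕ) : ℝ) ∈ Set.Icc (0 : ℝ) 1 := fun k hk =>
    ⟨by positivity, by rw [div_le_one hQ']; exact_mod_cast hk⟩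
  obtain ⟨A, hA⟩ := exists_learner_of_policy
    (fun r => mixture γ (levels γ θ r) (weights γ η θ r))
    (fun r x => (actionPrices (levels γ θ r) x).1 / ((2 ^ a * 2 ^ a : ℕ) : ℝ))
    (fun r x => (actionPrices (levels γ θ r) x).2 / ((2 ^ a * 2 ^ a : ℕ) : ℝ))
    (fun r => mixture_nonneg hγ hγ2 (hcard r) (hw0 r)) (fun r => sum_mixture (hw1 r))
    (fun r x => hmem _ (actionPrices_le _ x).1) (fun r x => hmem _ (actionPrices_le _ x).2)
  refine ⟨A, fun s b hsb => ?_⟩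
  obtain ⟨rec, act, hrec0, hrec, hp, hq, htail⟩ := hA s b
  refine ⟨fun ω => ?_, ?_⟩
  · have h : ∀ t ∈ Finset.range T,
        -(1 / 2 ^ a) ≤ rev (s t) (b t) (A.p s b ω t) (A.q s b ω t) := by
      intro t _
      have h1 : (0 : ℝ) ≤ 1 / 2 ^ a := by positivity
      unfold rev
      split_ifs
      · rw [hp, hq]
        have h2 := actionPrices_fst_le (levels γ θ (rec t ω)) (act t ω)
        have h3 : ((actionPrices (levels γ θ (rec t ω)) (act t ω)).1 : ℝ) ≤
            (actionPrices (levels γ θ (rec t ω)) (act t ω)).2 + 2 ^ a := by exact_mod_cast h2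
        have h4 : (1 : ℝ) / 2 ^ a = 2 ^ a / ((2 ^ a * 2 ^ a : ℕ) : ℝ) := by
          push_cast; field_simp
        rw [h4, ← sub_div, neg_le_iff_add_nonneg, ← add_div]
        exact div_nonneg (by linarith) hQ'.le
      · linarith
    have h5 := Finset.sum_le_sum h
    unfold Learner.violation
    simp only [Finset.sum_const, Finset.card_range, nsmul_eq_mul] at h5
    have : (T : ℝ) * -(1 / 2 ^ a) = -(T / 2 ^ a) := by ring
    linarith
  · obtain ⟨p, hpI, hpmax⟩ := (exists_benchmark_eq s b T).1
    obtain ⟨i', hi1, hi2⟩ := exists_cell hpI a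
    set σ : ℕ → ℕ := fun t => ⌈s t * (2 ^ a * 2 ^ a : ℕ)⌉₊ with hσ
    set τ : ℕ → ℕ := fun t => ⌊b t * (2 ^ a * 2 ^ a : ℕ)⌋₊ with hτ
    let V : ℕ → List (Action a × Bool) → Action a → ℝ := fun t r x =>
      bitVal (σ t) (τ t) (actionPrices (levels γ θ r) x)
    -- the terms of the supermartingales; rounds after the horizon do not count
    let f₀ : ℕ → List (Action a × Bool) → Action a → ℝ := fun t r x => if t < T then
      η * roundTerm γ η (s t) (b t) (levels γ θ r) (weights γ η θ r) i' x (V t r x) -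
        η * (16 * γ - gridGain (2 ^ a * 2 ^ a) (σ t) (τ t) (leafPrices (levels γ θ r) i')) else 0
    let f₁ : Block a → ℝ → ℕ → List (Action a × Bool) → Action a → ℝ := fun j ε t r x =>
      η * (ε * (countEst γ x (V t r x) j - inBlock (σ t) (τ t) j)) - η * γ
    have hf₀ : ∀ t r, ∑ x, mixture γ (levels γ θ r) (weights γ η θ r) x *
        Real.exp (f₀ t r x) ≤ 1 := by
      intro t r
      by_cases ht : t < T
      · simp only [f₀, if_pos ht]
        exact sum_mixture_exp_roundTerm_le hγ hγ2 hη (hcard r) (hw0 r) (hw1 r) (hsb t ht).1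
          (hsb t ht).2 i'
      · simp only [f₀, if_neg ht, Real.exp_zero, mul_one]
        exact (sum_mixture (hw1 r)).le
    have hf₁ : ∀ j (e : Bool) t r, ∑ x, mixture γ (levels γ θ r) (weights γ η θ r) x *
        Real.exp (f₁ j (if e then 1 else -1) t r x) ≤ 1 := fun j e t r =>
      sum_mixture_exp_countEst_le hγ hγ2 hη (hcard r) (hw0 r) (hw1 r) _ _ j
        (by split_ifs <;> norm_num)
    let B₀ : Set A.Ω := {ω | Real.log (1 / δ) < ∑ t ∈ Finset.range T, f₀ t (rec t ω) (act t ω)}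
    let B₁ : Block a × Fin T × Bool → Set A.Ω := fun k => {ω | lg <
      ∑ t ∈ Finset.range k.2.1, f₁ k.1 (if k.2.2 then 1 else -1) t (rec t ω) (act t ω)}
    have hB₀ : A.μ.real B₀ ≤ δ := by
      refine (htail f₀ hf₀ T _).trans_eq ?_
      rw [one_div, Real.log_inv, neg_neg, Real.exp_log hδ]
    have hB₁ : ∀ k, A.μ.real (B₁ k) ≤ δ / (2 ^ a * T) := fun k => by
      refine (htail _ (hf₁ k.1 k.2.2) k.2.1 lg).trans_eq ?_
      rw [hlg, Real.exp_neg, Real.exp_log (by positivity), inv_div]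
    have hB₁' : A.μ.real (⋃ k, B₁ k) ≤ 2 * δ := by
      refine (measureReal_iUnion_fintype_le _).trans ?_
      calc _ ≤ ∑ k : Block a × Fin T × Bool, δ / (2 ^ a * T) :=
            Finset.sum_le_sum fun k _ => hB₁ k
        _ = 2 * δ := by
            simp
            field_simp
    set G : Set A.Ω := {ω : A.Ω | A.regret s b T ω ≤
        16 * (γ * T) + 480 * (γ * T) * (Real.log (1 / δ) + Real.log (2 ^ a * 2 ^ a)) +
          3 * (T / (2 ^ a * 2 ^ a)) + 2886 * (T / (2 ^ a * 2 ^ a)) *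
            (1 + lg) * Real.log (T + 1)} with hG
    have hcover : Set.univ ⊆ G ∪ (B₀ ∪ ⋃ k, B₁ k) := by
      intro ω _
      by_cases hb0 : ω ∈ B₀
      · exact Or.inr (Or.inl hb0)
      by_cases hb1 : ω ∈ ⋃ k, B₁ k
      · exact Or.inr (Or.inr hb1)
      left
      have hbit : ∀ t < T, bitReal (trade (s t) (b t)
          ((actionPrices (levels γ θ (rec t ω)) (act t ω)).1 / ((2 ^ a * 2 ^ a : ℕ) : ℝ))
          ((actionPrices (levels γ θ (rec t ω)) (act t ω)).2 / ((2 ^ a * 2 ^ a : ℕ) : ℝ))) =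
          V t (rec t ω) (act t ω) := fun t ht => bitReal_trade hQ (hsb t ht).2.1 _
      have hcount : ∀ t < T, ∀ j : Block a, |cumCount γ (rec t ω) j -
          ∑ u ∈ Finset.range t, inBlock (σ u) (τ u) j| ≤ θ := by
        intro t ht j
        have hsum : cumCount γ (rec t ω) j =
            ∑ u ∈ Finset.range t, countEst γ (act u ω) (V u (rec u ω) (act u ω)) j := by
          rw [cumCount_eq_sum (r := fun t => rec t ω) (x := fun t => act t ω) (hrec0 ω)
            (fun t => hrec t ω) j t]
          refine Finset.sum_congr rfl fun u hu => ?_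
          rw [hbit u ((Finset.mem_range.1 hu).trans ht)]
        set D := cumCount γ (rec t ω) j - ∑ u ∈ Finset.range t, inBlock (σ u) (τ u) j with hD
        have hdev : ∀ e : Bool, η * ((if e then 1 else -1) * D) - η * γ * t ≤ lg := by
          intro e
          have hne : ω ∉ B₁ (j, ⟨t, ht⟩, e) := fun h => hb1 (Set.mem_iUnion.2 ⟨_, h⟩)
          simp only [B₁, Set.mem_ofPred_eq, not_lt] at hne
          have hle := hne
          simp only [f₁, Finset.sum_sub_distrib, ← Finset.mul_sum] at hle
          rw [← hsum, ← hD] at hle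
          simp only [Finset.sum_const, Finset.card_range, nsmul_eq_mul] at hle
          linarith
        have hbound : ∀ e : Bool, (if e then 1 else -1) * D ≤ θ := by
          intro e
          have h1 := hdev e
          have htT : (t : ℝ) ≤ T := by exact_mod_cast ht.le
          have h2 : (if e then 1 else -1) * D ≤ γ * t + lg * (1 / η) := by
            rw [mul_one_div, ← sub_le_iff_le_add', le_div_iff₀ hηpos]
            linarith
          rw [hηinv] at h2
          calc _ ≤ γ * t + lg * (480 * (γ * T)) := h2
            _ ≤ γ * T + lg * (480 * (γ * T)) := by gcongr
            _ ≤ 481 * (γ * T) * (1 + lg) := by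
                have : 0 < γ * T := by positivity
                nlinarith
            _ ≤ θ := by
                rw [hθ]
                gcongr
        have hb1 := hbound true
        have hb2 := hbound false
        simp only [if_true, Bool.false_eq_true, if_false] at hb1 hb2
        exact abs_le.2 ⟨by linarith, by linarith⟩
      have hmart := hb0
      simp only [B₀, Set.mem_ofPred_eq, not_lt] at hmart
      have hmart' : ∑ t ∈ Finset.range T,
          (η * roundTerm γ η (s t) (b t) (levels γ θ (rec t ω)) (weights γ η θ (rec t ω)) i'
            (act t ω) (bitReal (trade (s t) (b t)
          ((actionPrices (levels γ θ (rec t ω)) (act t ω)).1 / ((2 ^ a * 2 ^ a : ℕ) : ℝ))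
          ((actionPrices (levels γ θ (rec t ω)) (act t ω)).2 / ((2 ^ a * 2 ^ a : ℕ) : ℝ)))) -
            η * (16 * γ - gridGain (2 ^ a * 2 ^ a) (σ t) (τ t)
              (leafPrices (levels γ θ (rec t ω)) i'))) ≤ Real.log (1 / δ) := by
        refine le_trans (Finset.sum_le_sum fun t ht => ?_) hmart
        have ht := Finset.mem_range.1 ht
        simp only [f₀, if_pos ht]
        rw [hbit t ht]
      have hθT : (T : ℝ) ≤ θ * 2 ^ a := (div_le_iff₀ (by positivity)).1 hθ1
      have hfin := sum_gft_sub_le hγ hγ2 hη (hTK1.trans hθ1) hθT hsb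
        (r := fun t => rec t ω) (x := fun t => act t ω) (hrec0 ω) (fun t => hrec t ω) hi1 hi2
        hmart' hcount
      rw [hG, Set.mem_ofPred_eq]
      unfold Learner.regret
      rw [← hpmax]
      simp only [hp, hq]
      refine hfin.trans_eq ?_
      have e1 : (Real.log (1 / δ) + Real.log ((2 ^ a * 2 ^ a : ℕ) : ℝ)) / η =
          480 * (γ * T) * (Real.log (1 / δ) + Real.log (2 ^ a * 2 ^ a)) := by
        rw [← hηinv]
        push_cast
        ring
      rw [e1, hθ]
      ring
    have h1 : (1 : ℝ) ≤ A.μ.real G + (δ + 2 * δ) := by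
      calc (1 : ℝ) = A.μ.real Set.univ := by simp
        _ ≤ A.μ.real (G ∪ (B₀ ∪ ⋃ k, B₁ k)) := measureReal_mono hcover
        _ ≤ A.μ.real G + A.μ.real (B₀ ∪ ⋃ k, B₁ k) := measureReal_union_le _ _
        _ ≤ A.μ.real G + (δ + 2 * δ) := by
            gcongr
            exact (measureReal_union_le _ _).trans (add_le_add hB₀ hB₁')
    linarith

end BilateralTrade

end

theorem mainTheorem1 :
    ∃ (C : ℝ) (k : ℕ), 0 < C ∧
      ∀ β ∈ Set.Icc (3 / 4 : ℝ) (6 / 7), ∀ δ ∈ Set.Ioo (0 : ℝ) 1, ∀ T : ℕ, 1 ≤ T →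
        ∃ A : BilateralTrade.Learner, ∀ s b : ℕ → ℝ,
          (∀ t < T, s t ∈ Set.Icc (0 : ℝ) 1 ∧ b t ∈ Set.Icc (0 : ℝ) 1) →
            (∀ ω : A.Ω,
              A.violation s b T ω ≤ C * (T : ℝ) ^ β * (1 + Real.log (T : ℝ)) ^ k) ∧
            1 - 3 * δ ≤
              A.μ.real {ω : A.Ω | A.regret s b T ω ≤
                C * (T : ℝ) ^ (1 - β / 3) * (1 + Real.log ((T : ℝ) / δ)) ^ k} := by
  refine ⟨24000, 2, by norm_num, fun β hβ δ hδ T hT => ?_⟩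
  obtain ⟨hβ1, hβ2⟩ := hβ
  obtain ⟨hδ0, hδ1⟩ := hδ
  have hT1 : (1 : ℝ) ≤ T := by exact_mod_cast hT
  have hT0 : (0 : ℝ) < T := by linarith
  -- the number of blocks is the largest power of two below `T ^ (1 - β)`
  have hX1 : 1 ≤ (T : ℝ) ^ (1 - β) := Real.one_le_rpow hT1 (by linarith)
  obtain ⟨a, ha1, ha2⟩ := exists_nat_pow_near hX1 (one_lt_two : (1 : ℝ) < 2)
  have hK0 : (0 : ℝ) < 2 ^ a := by positivity
  have hK1 : (1 : ℝ) ≤ 2 ^ a := one_le_pow₀ (by norm_num)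
  have hKinv : 1 / (2 : ℝ) ^ a ≤ 2 * (T : ℝ) ^ (β - 1) := by
    have e : (T : ℝ) ^ (β - 1) = ((T : ℝ) ^ (1 - β))⁻¹ := by
      rw [← Real.rpow_neg hT0.le]; congr 1; ring
    rw [e, ← div_eq_mul_inv, div_le_div_iff₀ hK0 (by positivity)]
    rw [pow_succ] at ha2
    linarith
  -- `z / 2` is the probing parameter `γ`
  set z : ℝ := (2 ^ a / T : ℝ) ^ (1 / 3 : ℝ) with hz
  have hz0 : 0 < z := by positivity
  have hz3 : z ^ 3 = 2 ^ a / T := by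
    rw [hz, ← Real.rpow_natCast, ← Real.rpow_mul (by positivity)]
    norm_num
  have hKT : (2 : ℝ) ^ a ≤ T :=
    ha1.trans (by
      calc (T : ℝ) ^ (1 - β) ≤ (T : ℝ) ^ (1 : ℝ) :=
            Real.rpow_le_rpow_of_exponent_le hT1 (by linarith)
        _ = T := Real.rpow_one _)
  have hz1 : z ≤ 1 := Real.rpow_le_one (by positivity) ((div_le_one hT0).2 hKT) (by norm_num)
  have hzT : z * T ≤ (T : ℝ) ^ (1 - β / 3) := by
    have h1 : (2 : ℝ) ^ a / T ≤ (T : ℝ) ^ (-β) := by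
      rw [div_le_iff₀ hT0]
      calc (2 : ℝ) ^ a ≤ (T : ℝ) ^ (1 - β) := ha1
        _ = (T : ℝ) ^ (-β) * T := by
            rw [← Real.rpow_add_one hT0.ne']; congr 1; ring
    have h2 : z ≤ ((T : ℝ) ^ (-β)) ^ (1 / 3 : ℝ) :=
      Real.rpow_le_rpow (by positivity) h1 (by norm_num)
    rw [← Real.rpow_mul hT0.le] at h2
    calc z * T ≤ (T : ℝ) ^ (-β * (1 / 3)) * T := mul_le_mul_of_nonneg_right h2 hT0.le
      _ = (T : ℝ) ^ (1 - β / 3) := by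
          rw [← Real.rpow_add_one hT0.ne']; congr 1; ring
  -- this is where `3 / 4 ≤ β` is needed
  have hzK : z * 2 ^ a ≤ 1 := by
    have h1 : (2 ^ a : ℝ) ^ 4 ≤ T := by
      calc (2 ^ a : ℝ) ^ 4 ≤ ((T : ℝ) ^ (1 - β)) ^ 4 := pow_le_pow_left₀ hK0.le ha1 4
        _ = (T : ℝ) ^ ((1 - β) * 4) := by
            rw [← Real.rpow_natCast, ← Real.rpow_mul hT0.le]; norm_num
        _ ≤ (T : ℝ) ^ (1 : ℝ) := Real.rpow_le_rpow_of_exponent_le hT1 (by linarith)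
        _ = T := Real.rpow_one _
    have h2 : (z * 2 ^ a) ^ 3 ≤ 1 := by
      rw [mul_pow, hz3, div_mul_eq_mul_div, div_le_one hT0]
      linarith [h1]
    by_contra hc
    exact absurd h2 (not_le.2 (one_lt_pow₀ (not_le.1 hc) (by norm_num)))
  obtain ⟨A, hA⟩ := BilateralTrade.exists_learner_of_tuning (a := a) (γ := z / 2) hT
    (by positivity) (by linarith)
    (by rw [div_pow, hz3]; field_simp; norm_num) (by nlinarith) hδ0 hδ1
  refine ⟨A, fun s b hsb => ?_⟩
  obtain ⟨hviol, hreg⟩ := hA s b hsb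
  constructor
  · intro ω
    refine (hviol ω).trans ?_
    have hlog : 0 ≤ Real.log T := Real.log_nonneg hT1
    have h1 : T / (2 : ℝ) ^ a ≤ 2 * (T : ℝ) ^ β := by
      calc T / (2 : ℝ) ^ a = 1 / 2 ^ a * T := by ring
        _ ≤ 2 * (T : ℝ) ^ (β - 1) * T := mul_le_mul_of_nonneg_right hKinv hT0.le
        _ = 2 * (T : ℝ) ^ β := by
            rw [mul_assoc, ← Real.rpow_add_one hT0.ne']; congr 2; ring
    have h2 : 1 ≤ (1 + Real.log T) ^ 2 := one_le_pow₀ (by linarith)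
    have h3 : 0 ≤ (T : ℝ) ^ β := by positivity
    nlinarith
  · refine hreg.trans (measureReal_mono fun ω hω => ?_)
    rw [Set.mem_ofPred_eq] at hω ⊢
    refine hω.trans ?_
    set Y : ℝ := (T : ℝ) ^ (1 - β / 3) with hY
    have hY0 : 0 ≤ Y := by positivity
    set l : ℝ := 1 + Real.log (T / δ) with hl
    have hlogT : 0 ≤ Real.log T := Real.log_nonneg hT1
    have hlogδ : 0 ≤ Real.log (1 / δ) := Real.log_nonneg (by rw [le_div_iff₀ hδ0]; linarith)
    have hsplit : Real.log (T / δ) = Real.log T + Real.log (1 / δ) := by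
      rw [← Real.log_mul hT0.ne' (by positivity), mul_one_div]
    have hlogK : Real.log (2 ^ a) ≤ Real.log T := Real.log_le_log hK0 hKT
    have hlogK0 : 0 ≤ Real.log ((2 : ℝ) ^ a) := Real.log_nonneg hK1
    have hl1 : 1 ≤ l := by linarith
    have hL1 : Real.log (1 / δ) + Real.log (2 ^ a * 2 ^ a) ≤ 2 * l := by
      rw [Real.log_mul hK0.ne' hK0.ne']
      linarith
    have hL10 : 0 ≤ Real.log (1 / δ) + Real.log (2 ^ a * 2 ^ a) := by
      rw [Real.log_mul hK0.ne' hK0.ne']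
      linarith
    have hL20 : 0 ≤ 1 + Real.log (2 ^ a * T / δ) := by
      rw [mul_div_assoc, Real.log_mul hK0.ne' (by positivity)]
      linarith
    have hL2 : 1 + Real.log (2 ^ a * T / δ) ≤ 2 * l := by
      rw [mul_div_assoc, Real.log_mul hK0.ne' (by positivity)]
      linarith
    have hL3 : Real.log (T + 1) ≤ l := by
      have h1 : Real.log (T + 1) ≤ Real.log (T * 2) := Real.log_le_log (by linarith) (by linarith)
      rw [Real.log_mul hT0.ne' (by norm_num)] at h1
      linarith [Real.log_two_lt_d9]
    have hL30 : 0 ≤ Real.log ((T : ℝ) + 1) := Real.log_nonneg (by linarith)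
    -- this is where `β ≤ 6 / 7` is needed
    have hTQ : (T : ℝ) / (2 ^ a * 2 ^ a) ≤ 4 * Y := by
      calc (T : ℝ) / (2 ^ a * 2 ^ a) = 1 / 2 ^ a * (1 / 2 ^ a) * T := by field_simp
        _ ≤ 2 * (T : ℝ) ^ (β - 1) * (2 * (T : ℝ) ^ (β - 1)) * T := by gcongr
        _ = 4 * (T : ℝ) ^ ((β - 1) + (β - 1) + 1) := by
            rw [Real.rpow_add_one hT0.ne', Real.rpow_add hT0]; ring
        _ ≤ 4 * Y := by
            have := Real.rpow_le_rpow_of_exponent_le hT1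
              (show (β - 1) + (β - 1) + 1 ≤ 1 - β / 3 by linarith)
            linarith
    have hTQ0 : 0 ≤ (T : ℝ) / (2 ^ a * 2 ^ a) := by positivity
    have hzT' : z / 2 * T ≤ Y / 2 := by linarith
    have hll : l ≤ l ^ 2 := by nlinarith
    have hYl : Y * l ≤ Y * l ^ 2 := mul_le_mul_of_nonneg_left hll hY0
    have hYY : Y ≤ Y * l := le_mul_of_one_le_right hY0 hl1
    have t2 : 480 * (z / 2 * T) * (Real.log (1 / δ) + Real.log (2 ^ a * 2 ^ a)) ≤
        480 * (Y / 2) * (2 * l) :=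
      mul_le_mul (by linarith) hL1 hL10 (by linarith)
    have t4 : 2886 * (T / (2 ^ a * 2 ^ a)) * (1 + Real.log (2 ^ a * T / δ)) *
        Real.log (T + 1) ≤ 2886 * (4 * Y) * (2 * l) * l :=
      mul_le_mul (mul_le_mul (by linarith) hL2 hL20 (by linarith)) hL3 hL30
        (mul_nonneg (by linarith) (by linarith))
    have e2 : 480 * (Y / 2) * (2 * l) = 480 * (Y * l) := by ring
    have e4 : 2886 * (4 * Y) * (2 * l) * l = 23088 * (Y * l ^ 2) := by ring
    rw [mul_assoc 24000]
    linarith
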